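/- Let $X_1,X_2,\dots$ be independent, identically distributed real random variables with an absolutely continuous distribution function and probability density $f$, with finite variance. Assume that the varextropy $$VJ(X)=\operatorname{Var}\!\left(-\tfrac12 f(X)\right)=\tfrac14\int f^3(x)\,dx-\tfrac14\left[\int f^2(x)\,dx\right]^2$$ of $X=X_1$ is defined and finite, i.e. $\int f^3(x)\,dx<\infty$. For $n\ge 1$ let $X_{1:n}\le\dots\le X_{n:n}$ be the order statistics of $X_1,\dots,X_n$, with the convention $X_{j:n}=X_{1:n}$ for $j<1$ and $X_{j:n}=X_{n:n}$ for $j>n$. For a window size $m$ put $$\bar X_{i:n}=\frac1{2m+1}\sum_{j=i-m}^{i+m}X_{j:n},\qquad b_{i}=\frac{\sum_{j=i-m}^{i+m}(X_{j:n}-\bar X_{i:n})(j-i)}{n\sum_{j=i-m}^{i+m}(X_{j:n}-\bar X_{i:n})^2}\quad(1\le i\le n),$$ so that $b_i$ is the slope of the local linear least squares fit on the window around $X_{i:n}$, and let $$\widehat{\Delta}_5=\frac1{4n}\sum_{i=1}^n b_i^{2}-\frac14\left[\frac1n\sum_{i=1}^n b_i\right]^2 .$$ If $m=m(n)$ satisfies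 $m\to\infty$ and $m/n\to0$ as $n\to\infty$, then $\widehat{\Delta}_5$ converges in probability to $VJ(X)$ as $n\to\infty$. -/

import Mathlib

open MeasureTheory ProbabilityTheory Filter

noncomputable section

/-- `f` is a probability density function of the real random variable `X` under `P`: it is
nonnegative and measurable, and the law of `X` is `f(x) dx`. -/
structure IsPdfOf {Ω : Type*} [MeasurableSpace Ω] (f : ℝ → ℝ) (X : Ω → ℝ) (P : Measure Ω) :
    Prop where
  measurable : Measurable f
  nonneg : ∀ x, 0 ≤ f x
  aemeasurable : AEMeasurable X P
  map_eq : P.map X = volume.withDensity (fun x => ENNReal.ofReal (f x))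

/-- The varextropy `VJ(X) = Var(-f(X)/2)` of a random variable `X` with density `f`. -/
def varextropy {Ω : Type*} [MeasurableSpace Ω] (f : ℝ → ℝ) (X : Ω → ℝ) (P : Measure Ω) : ℝ :=
  variance (fun ω => -(1 / 2) * f (X ω)) P

/-- The order statistic `X_{j:n}` of the sample `x₁, …, xₙ` (indexed by `Fin n`), that is the
`j`-th smallest value, with `X_{j:n} = X_{1:n}` for `j < 1` and `X_{j:n} = X_{n:n}` for `j > n`.
(It is `0` for the empty sample.) -/
def orderStat {n : ℕ} (x : Fin n → ℝ) (j : ℤ) : ℝ :=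
  if h : 0 < n then x (Tuple.sort x ⟨(max 1 (min j n) - 1).toNat, by omega⟩) else 0

/-- The window mean `X̄_{i:n} = (2m+1)⁻¹ ∑_{j=i-m}^{i+m} X_{j:n}`. -/
def windowMean {n : ℕ} (m : ℕ) (x : Fin n → ℝ) (i : ℤ) : ℝ :=
  1 / (2 * (m : ℝ) + 1) * ∑ j ∈ Finset.Icc (i - m) (i + m), orderStat x j

/-- The least squares slope at `X_{i:n}` in the local linear model on the `2m+1` order statistics
`X_{i-m:n}, …, X_{i+m:n}`. -/
def localSlope {n : ℕ} (m : ℕ) (x : Fin n → ℝ) (i : ℤ) : ℝ :=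
  (∑ j ∈ Finset.Icc (i - m) (i + m), (orderStat x j - windowMean m x i) * ((j : ℝ) - (i : ℝ))) /
    ((n : ℝ) * ∑ j ∈ Finset.Icc (i - m) (i + m), (orderStat x j - windowMean m x i) ^ 2)

/-- The Correa-type estimator `Δ̂₅` of varextropy with window size `m`, evaluated at the sample
`x₁, …, xₙ`. -/
def correaVarextropy {n : ℕ} (m : ℕ) (x : Fin n → ℝ) : ℝ :=
  1 / (4 * (n : ℝ)) * ∑ i ∈ Finset.Icc (1 : ℤ) n, localSlope m x i ^ 2 -
    1 / 4 * (1 / (n : ℝ) * ∑ i ∈ Finset.Icc (1 : ℤ) n, localSlope m x i) ^ 2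

end

/-! The slope attached to a sample point `X_l` estimates the density there, so the estimator is a
quarter of the empirical variance of numbers close to `f (X_l)`. It suffices that the mean square
error of the slopes against the `f (X_l)` tends to zero in mean: Cauchy–Schwarz then compares the
first two empirical moments of both families, and the strong law sends those of `f (X_l)` to `E
f(X)` and `E f(X)² = ∫ f³`.

Conditioning on `X_l = x` leaves an independent sample of the remaining points, so the error becomes
the integral over `x` of a risk at a fixed point (`lintegral_slopeError`). At almost every `x` for
the law, the distribution function has derivative `f x > 0`. Chebyshev's inequality at finitely many
points, at distances of order `m / n` from `x`, makes the empirical counts nearly linear there;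
hence so are the order statistics of the window, and the slope is close to `f x` with high
probability (`eventually_measure_slopeAt_le`).

Convergence in probability must be upgraded to mean square. A slope can be large only if about `m /
2` points crowd near `x`, and a union bound controls this event through the Hardy–Littlewood maximal
function `M` of the law (`measure_lt_abs_slopeAt_le`). The resulting third moment bound gives
uniform integrability at fixed `x`, and dominates the risk by a multiple of `M² + f² + 1`. Since `f
∈ L³` forces `M ∈ L³`, this is integrable for the law, and dominated convergence applies
(`tendsto_lintegral_slopeAt`). -/

noncomputable section

/-! ### Order statistics, ranks and counts -/

section OrderStatistics

lemma orderStat_monotone {n : ℕ} (z : Fin n → ℝ) : Monotone (orderStat z) := by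
  intro i j hij
  unfold orderStat
  split_ifs with h
  · refine Tuple.monotone_sort z (a := ⟨_, _⟩) (b := ⟨_, _⟩) ?_
    simp only [Fin.mk_le_mk]
    omega
  · exact le_rfl

lemma card_filter_comp_sort {n : ℕ} (z : Fin n → ℝ) (p : ℝ → Prop) [DecidablePred p] :
    (Finset.univ.filter fun a => p (z (Tuple.sort z a))).card =
      (Finset.univ.filter fun a => p (z a)).card :=
  Finset.card_equiv (Tuple.sort z) (by simp)

/-- The duality that turns statements on order statistics into statements on counts, which are sums
of independent indicators. It needs `j` in range because `orderStat` clamps its index. -/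
lemma orderStat_le_iff {n : ℕ} (z : Fin n → ℝ) {j : ℤ} (h1 : 1 ≤ j) (hn : j ≤ n) (c : ℝ) :
    orderStat z j ≤ c ↔ j ≤ ((Finset.univ.filter fun a => z a ≤ c).card : ℤ) := by
  have h0 : 0 < n := by omega
  unfold orderStat
  rw [dif_pos h0, ← card_filter_comp_sort z (· ≤ c)]
  have := Tuple.lt_card_le_iff_apply_le_of_monotone (f := z ∘ Tuple.sort z)
    (j := ⟨(max 1 (min j n) - 1).toNat, by omega⟩) (a := c) (Tuple.monotone_sort z)
  simp only [Function.comp_apply] at this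
  rw [← this]
  omega

/-- The rank of the `l`-th sample point, ties being broken as by `Tuple.sort`. -/
def sampleRank {n : ℕ} (z : Fin n → ℝ) (l : Fin n) : ℤ :=
  (((Tuple.sort z).symm l : Fin n) : ℕ) + 1

lemma one_le_sampleRank {n : ℕ} (z : Fin n → ℝ) (l : Fin n) : 1 ≤ sampleRank z l := by
  unfold sampleRank; omega

lemma sampleRank_le {n : ℕ} (z : Fin n → ℝ) (l : Fin n) : sampleRank z l ≤ n := by
  unfold sampleRank; omega

lemma orderStat_sampleRank {n : ℕ} (z : Fin n → ℝ) (l : Fin n) :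
    orderStat z (sampleRank z l) = z l := by
  have h1 := one_le_sampleRank z l
  have h2 := sampleRank_le z l
  unfold orderStat
  rw [dif_pos l.pos]
  have : (⟨(max 1 (min (sampleRank z l) n) - 1).toNat, by omega⟩ : Fin n) =
      (Tuple.sort z).symm l := by
    ext
    unfold sampleRank at *
    simp only
    omega
  rw [this, Equiv.apply_symm_apply]

/-- Ranks permute the sample, so a sum over ranks can be attached to the sample points, one of which
can then be conditioned on. -/
lemma sum_Icc_eq_sum_sampleRank {n : ℕ} (z : Fin n → ℝ) (φ : ℤ → ℝ) :
    ∑ i ∈ Finset.Icc (1 : ℤ) n, φ i = ∑ l, φ (sampleRank z l) := by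
  symm
  refine Finset.sum_bij (fun l _ => sampleRank z l)
    (fun l _ => Finset.mem_Icc.2 ⟨one_le_sampleRank z l, sampleRank_le z l⟩) ?_ ?_
    (fun _ _ => rfl)
  · intro a _ b _ hab
    unfold sampleRank at hab
    exact (Tuple.sort z).symm.injective (Fin.ext (by omega))
  · intro i hi
    rw [Finset.mem_Icc] at hi
    refine ⟨Tuple.sort z ⟨(i - 1).toNat, by omega⟩, Finset.mem_univ _, ?_⟩
    unfold sampleRank
    rw [Equiv.symm_apply_apply]
    simp only
    omega

/-- If the count exceeded the rank, the next order statistic would have the same value and come from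
another index, which the absence of ties at `l` forbids. -/
lemma sampleRank_eq_card {n : ℕ} (z : Fin n → ℝ) (l : Fin n)
    (hl : ∀ a, z a = z l → a = l) :
    sampleRank z l = ((Finset.univ.filter fun a => z a ≤ z l).card : ℤ) := by
  have h1 := one_le_sampleRank z l
  have h2 := sampleRank_le z l
  refine le_antisymm ((orderStat_le_iff z h1 h2 _).1 (orderStat_sampleRank z l).le) ?_
  by_contra! hlt
  have hcard : (Finset.univ.filter fun a => z a ≤ z l).card ≤ n := by
    simpa using Finset.card_le_univ (Finset.univ.filter fun a => z a ≤ z l)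
  have hle : orderStat z (sampleRank z l + 1) ≤ z l :=
    (orderStat_le_iff z (by omega) (by omega) _).2 (by omega)
  have hge : z l ≤ orderStat z (sampleRank z l + 1) :=
    (orderStat_sampleRank z l).symm.le.trans (orderStat_monotone z (by omega))
  have heq := le_antisymm hle hge
  obtain ⟨b, hb⟩ : ∃ b, sampleRank z b = sampleRank z l + 1 := by
    refine ⟨Tuple.sort z ⟨(sampleRank z l).toNat, by omega⟩, ?_⟩
    rw [sampleRank, Equiv.symm_apply_apply]
    simp only
    omega
  have := hl b (by rw [← orderStat_sampleRank z b, hb, heq])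
  rw [this] at hb
  omega

/-- If few sample points are within distance `r` of the `l`-th one, then the order statistics
around it are spread out. -/
lemma lt_orderStat_sub_orderStat {n : ℕ} (z : Fin n → ℝ) (l : Fin n) (k : ℕ) (hk : k + 1 ≤ n)
    {r : ℝ} (hcard : (Finset.univ.filter fun a => |z a - z l| ≤ r).card ≤ k) :
    r < orderStat z (sampleRank z l + k) - orderStat z (sampleRank z l - k) := by
  by_contra! hle
  have h1 := one_le_sampleRank z l
  have h2 := sampleRank_le z l
  have hx := orderStat_sampleRank z l
  set i := sampleRank z l with hi
  have hmono := orderStat_monotone z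
  -- Every rank in the clipped window belongs to a point within `r` of `z l`. As `k + 1 ≤ n`,
  -- clipping to `[1, n]` still leaves at least `k + 1` ranks.
  have hsub : (Finset.Icc (max 1 (i - k)) (min n (i + k))).card ≤
      (Finset.univ.filter fun a => |z a - z l| ≤ r).card := by
    refine Finset.card_le_card_of_surjOn (sampleRank z) ?_
    intro j hj
    simp only [Finset.coe_Icc, Set.mem_Icc] at hj
    have hb : sampleRank z (Tuple.sort z ⟨(j - 1).toNat, by omega⟩) = j := by
      rw [sampleRank, Equiv.symm_apply_apply]
      simp only
      omega
    refine ⟨_, ?_, hb⟩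
    simp only [Finset.coe_filter, Finset.mem_univ, true_and, Set.mem_ofPred_eq]
    rw [← orderStat_sampleRank z (Tuple.sort z _), hb, abs_le, ← hx]
    have a1 := hmono (show i - k ≤ j by omega)
    have a2 := hmono (show j ≤ i + k by omega)
    have a3 := hmono (show i - k ≤ i by omega)
    have a4 := hmono (show i ≤ i + k by omega)
    constructor <;> linarith
  rw [Int.card_Icc] at hsub
  omega

end OrderStatistics

/-! ### Deterministic bounds for the least squares slope -/

section Regression

lemma sum_window_card (m : ℕ) (i : ℤ) :
    ((Finset.Icc (i - m) (i + m)).card : ℝ) = 2 * m + 1 := by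
  rw [Int.card_Icc]
  have : (i + m + 1 - (i - m)).toNat = 2 * m + 1 := by omega
  rw [this]; push_cast; ring

lemma sum_window_sq (m : ℕ) (i : ℤ) :
    ∑ j ∈ Finset.Icc (i - m) (i + m), ((j : ℝ) - i) ^ 2 =
      (m : ℝ) * (m + 1) * (2 * m + 1) / 3 := by
  induction m with
  | zero => simp
  | succ k ih =>
    have : Finset.Icc (i - (k + 1 : ℕ)) (i + (k + 1 : ℕ)) =
        insert (i - (k + 1 : ℕ)) (insert (i + (k + 1 : ℕ)) (Finset.Icc (i - k) (i + k))) := by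
      ext j; simp only [Finset.mem_Icc, Finset.mem_insert]; omega
    rw [this, Finset.sum_insert, Finset.sum_insert, ih]
    · push_cast; ring
    · simp only [Finset.mem_Icc]; omega
    · simp only [Finset.mem_Icc, Finset.mem_insert]; omega

lemma sum_window_sub (m : ℕ) (i : ℤ) :
    ∑ j ∈ Finset.Icc (i - m) (i + m), ((j : ℝ) - i) = 0 := by
  induction m with
  | zero => simp
  | succ k ih =>
    have : Finset.Icc (i - (k + 1 : ℕ)) (i + (k + 1 : ℕ)) =
        insert (i - (k + 1 : ℕ)) (insert (i + (k + 1 : ℕ)) (Finset.Icc (i - k) (i + k))) := by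
      ext j; simp only [Finset.mem_Icc, Finset.mem_insert]; omega
    rw [this, Finset.sum_insert, Finset.sum_insert, ih]
    · push_cast; ring
    · simp only [Finset.mem_Icc]; omega
    · simp only [Finset.mem_Icc, Finset.mem_insert]; omega

lemma card_mul_sq_le_sum_sq {s t : Finset ℤ} (hst : t ⊆ s) (u : ℤ → ℝ) {a : ℝ}
    (h : ∀ j ∈ t, a ^ 2 ≤ u j ^ 2) : (t.card : ℝ) * a ^ 2 ≤ ∑ j ∈ s, u j ^ 2 := by
  calc (t.card : ℝ) * a ^ 2 = ∑ _j ∈ t, a ^ 2 := by simp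
    _ ≤ ∑ j ∈ t, u j ^ 2 := Finset.sum_le_sum h
    _ ≤ ∑ j ∈ s, u j ^ 2 := Finset.sum_le_sum_of_subset_of_nonneg hst fun _ _ _ => sq_nonneg _

/-- A monotone sequence which increases by `g` over the central half of a window has a large
sum of squared deviations on the window. -/
lemma spread_le_sum_sq {o : ℤ → ℝ} (ho : Monotone o) (m : ℕ) (i : ℤ) (c : ℝ)
    {g : ℝ} (hg0 : 0 ≤ g) (hg : g ≤ o (i + (m / 2 : ℕ)) - o (i - (m / 2 : ℕ))) :
    (m : ℝ) * g ^ 2 / 8 ≤ ∑ j ∈ Finset.Icc (i - m) (i + m), (o j - c) ^ 2 := by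
  have key : ∀ t : Finset ℤ, t ⊆ Finset.Icc (i - m) (i + m) → t.card = m - m / 2 + 1 →
      (∀ j ∈ t, (g / 2) ^ 2 ≤ (o j - c) ^ 2) →
      (m : ℝ) * g ^ 2 / 8 ≤ ∑ j ∈ Finset.Icc (i - m) (i + m), (o j - c) ^ 2 := by
    intro t ht hc h
    refine le_trans ?_ (card_mul_sq_le_sum_sq ht (fun j => o j - c) h)
    have : m ≤ 2 * t.card := by omega
    have : (m : ℝ) ≤ 2 * (t.card : ℝ) := by exact_mod_cast this
    nlinarith [sq_nonneg g]
  -- On the side of the midpoint away from `c`, all points of the outer half-window are at distance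
  -- at least `g / 2` from `c`.
  rcases le_total c ((o (i + (m / 2 : ℕ)) + o (i - (m / 2 : ℕ))) / 2) with h | h
  · refine key (Finset.Icc (i + (m / 2 : ℕ)) (i + m)) ?_ ?_ ?_
    · exact Finset.Icc_subset_Icc (by omega) le_rfl
    · rw [Int.card_Icc]; omega
    · intro j hj
      have := ho (Finset.mem_Icc.1 hj).1
      exact pow_le_pow_left₀ (by positivity) (by linarith) 2
  · refine key (Finset.Icc (i - m) (i - (m / 2 : ℕ))) ?_ ?_ ?_
    · exact Finset.Icc_subset_Icc le_rfl (by omega)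
    · rw [Int.card_Icc]; omega
    · intro j hj
      have := ho (Finset.mem_Icc.1 hj).2
      rw [← neg_sq (o j - c)]
      exact pow_le_pow_left₀ (by positivity) (by linarith) 2

/-- A local slope is at most of the order of the number of points in the window divided by
the spread of the window. -/
lemma abs_localSlope_le {n : ℕ} (hn : 0 < n) (z : Fin n → ℝ) {m : ℕ} (hm : 0 < m) (i : ℤ)
    {g : ℝ} (hg0 : 0 < g)
    (hg : g ≤ orderStat z (i + (m / 2 : ℕ)) - orderStat z (i - (m / 2 : ℕ))) :
    |localSlope m z i| ≤ 5 * m / (n * g) := by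
  have hn' : (0 : ℝ) < n := by exact_mod_cast hn
  have hm' : (1 : ℝ) ≤ m := by exact_mod_cast hm
  have hS := spread_le_sum_sq (orderStat_monotone z) m i (windowMean m z i) hg0.le hg
  -- Cauchy–Schwarz gives `N² ≤ 3 m³ S`; with `S ≥ m g² / 8` this yields `(N / S)² ≤ 24 m² / g²`,
  -- and `24 ≤ 5²`.
  have hCS := Finset.sum_mul_sq_le_sq_mul_sq (Finset.Icc (i - m) (i + m))
    (fun j => orderStat z j - windowMean m z i) (fun j => (j : ℝ) - i)
  rw [sum_window_sq] at hCS
  unfold localSlope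
  set S := ∑ j ∈ Finset.Icc (i - m) (i + m), (orderStat z j - windowMean m z i) ^ 2
  set N := ∑ j ∈ Finset.Icc (i - m) (i + m),
    (orderStat z j - windowMean m z i) * ((j : ℝ) - (i : ℝ))
  clear_value S N
  have hS0 : 0 < S := lt_of_lt_of_le (by positivity) hS
  have hQ : (m : ℝ) * (m + 1) * (2 * m + 1) / 3 ≤ 3 * m ^ 3 := by nlinarith [sq_nonneg (m : ℝ)]
  refine abs_le_of_sq_le_sq ?_ (by positivity)
  rw [div_pow, div_pow, div_le_div_iff₀ (by positivity) (by positivity)]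
  have h1 : N ^ 2 ≤ S * (3 * m ^ 3) := hCS.trans (mul_le_mul_of_nonneg_left hQ hS0.le)
  have h2 : N ^ 2 * (m * g ^ 2) ≤ (S * (3 * m ^ 3)) * (8 * S) := by
    refine mul_le_mul h1 (by linarith) (by positivity) (by positivity)
  have h3 : N ^ 2 * g ^ 2 ≤ 24 * m ^ 2 * S ^ 2 := by
    refine le_of_mul_le_mul_left ?_ (show (0 : ℝ) < m by linarith)
    calc (m : ℝ) * (N ^ 2 * g ^ 2) = N ^ 2 * (m * g ^ 2) := by ring
      _ ≤ _ := h2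
      _ = _ := by ring
  have h4 : 24 * (m : ℝ) ^ 2 * S ^ 2 ≤ 25 * m ^ 2 * S ^ 2 := by gcongr; norm_num
  calc N ^ 2 * (n * g) ^ 2 = n ^ 2 * (N ^ 2 * g ^ 2) := by ring
    _ ≤ n ^ 2 * (25 * m ^ 2 * S ^ 2) := 
        mul_le_mul_of_nonneg_left (h3.trans h4) (sq_nonneg _)
    _ = _ := by ring

/-- If the order statistics in the window are nearly equally spaced, the local slope is nearly
the reciprocal of the spacing. -/
lemma abs_localSlope_sub_le {n : ℕ} (hn : 0 < n) (z : Fin n → ℝ) {m : ℕ} (hm : 0 < m) (i : ℤ)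
    {x D ε : ℝ} (hD : 0 < D) (hε0 : 0 ≤ ε) (hε : ε ≤ 1 / 60)
    (h : ∀ j ∈ Finset.Icc (i - m) (i + m), |orderStat z j - x - D * (j - i)| ≤ ε * (D * m)) :
    |localSlope m z i - 1 / (n * D)| ≤ 50 * ε * (1 / (n * D)) := by
  have hn' : (0 : ℝ) < n := by exact_mod_cast hn
  have hm' : (1 : ℝ) ≤ m := by exact_mod_cast hm
  set W := Finset.Icc (i - m) (i + m) with hW
  have hcard : (W.card : ℝ) = 2 * m + 1 := sum_window_card m i
  -- `e` is the departure from exact linearity. The regressor `j - i` sums to zero over the window,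
  -- so means drop out of the cross terms.
  set e : ℤ → ℝ := fun j => orderStat z j - x - D * (j - i) with he
  set E := 1 / (2 * (m : ℝ) + 1) * ∑ j ∈ W, e j with hE
  have ho : ∀ j, orderStat z j = x + D * (j - i) + e j := fun j => by simp only [he]; ring
  have hmean : windowMean m z i = x + E := by
    unfold windowMean
    simp_rw [ho]
    rw [← hW, Finset.sum_add_distrib, Finset.sum_add_distrib, ← Finset.mul_sum, hW,
      sum_window_sub, ← hW, Finset.sum_const, nsmul_eq_mul, hcard, hE]
    field_simp
    ring
  set Q := ∑ j ∈ W, ((j : ℝ) - i) ^ 2 with hQ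
  have hQv : Q = (m : ℝ) * (m + 1) * (2 * m + 1) / 3 := sum_window_sq m i
  have hQ0 : 0 < Q := by rw [hQv]; positivity
  have hQm : (m : ℝ) ^ 2 * (2 * m + 1) ≤ 3 * Q := by rw [hQv]; nlinarith
  set A := ∑ j ∈ W, e j * ((j : ℝ) - i) with hA
  have hw : ∀ j ∈ W, |(j : ℝ) - i| ≤ m := by
    intro j hj
    rw [hW, Finset.mem_Icc] at hj
    rw [abs_le]
    have h1 : ((i - m : ℤ) : ℝ) ≤ j := by exact_mod_cast hj.1
    have h2 : (j : ℝ) ≤ ((i + m : ℤ) : ℝ) := by exact_mod_cast hj.2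
    push_cast at h1 h2
    constructor <;> linarith
  have hAb : |A| ≤ 3 * ε * (D * Q) := by
    calc |A| ≤ ∑ j ∈ W, |e j * ((j : ℝ) - i)| := Finset.abs_sum_le_sum_abs _ _
      _ ≤ ∑ _j ∈ W, ε * (D * m) * m := by
        refine Finset.sum_le_sum fun j hj => ?_
        rw [abs_mul]
        exact mul_le_mul (h j hj) (hw j hj) (abs_nonneg _) (by positivity)
      _ = ε * D * (m ^ 2 * (2 * m + 1)) := by
        rw [Finset.sum_const, nsmul_eq_mul, hcard]; ring
      _ ≤ ε * D * (3 * Q) := by gcongr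
      _ = _ := by ring
  have hEb : |E| ≤ ε * (D * m) := by
    rw [hE, abs_mul, abs_of_pos (by positivity)]
    calc 1 / (2 * (m : ℝ) + 1) * |∑ j ∈ W, e j|
        ≤ 1 / (2 * (m : ℝ) + 1) * ∑ j ∈ W, |e j| := by
          gcongr; exact Finset.abs_sum_le_sum_abs _ _
      _ ≤ 1 / (2 * (m : ℝ) + 1) * ∑ _j ∈ W, ε * (D * m) := by
          gcongr with j hj; exact h j hj
      _ = ε * (D * m) := by
          rw [Finset.sum_const, nsmul_eq_mul, hcard]; field_simp
  set R := ∑ j ∈ W, (e j - E) ^ 2 with hR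
  have hR0 : 0 ≤ R := Finset.sum_nonneg fun _ _ => sq_nonneg _
  have hRb : R ≤ 12 * ε ^ 2 * (D ^ 2 * Q) := by
    calc R ≤ ∑ _j ∈ W, (2 * (ε * (D * m))) ^ 2 := by
          refine Finset.sum_le_sum fun j hj => ?_
          rw [← sq_abs]
          refine pow_le_pow_left₀ (abs_nonneg _) ?_ 2
          exact (abs_sub _ _).trans (by have := h j hj; simp only [he]; linarith)
      _ = 4 * ε ^ 2 * D ^ 2 * (m ^ 2 * (2 * m + 1)) := by
          rw [Finset.sum_const, nsmul_eq_mul, hcard]; ring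
      _ ≤ 4 * ε ^ 2 * D ^ 2 * (3 * Q) := by gcongr
      _ = _ := by ring
  have hN : ∑ j ∈ W, (orderStat z j - windowMean m z i) * ((j : ℝ) - (i : ℝ)) = D * Q + A := by
    have h1 : ∀ j, (orderStat z j - windowMean m z i) * ((j : ℝ) - (i : ℝ)) =
        D * ((j : ℝ) - i) ^ 2 + e j * (j - i) - E * (j - i) := fun j => by
      rw [hmean, ho j]; ring
    simp_rw [h1]
    rw [Finset.sum_sub_distrib, Finset.sum_add_distrib, ← Finset.mul_sum, ← Finset.mul_sum, hW,
      sum_window_sub, ← hW]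
    ring
  have hS : ∑ j ∈ W, (orderStat z j - windowMean m z i) ^ 2 = D ^ 2 * Q + 2 * D * A + R := by
    have h1 : ∀ j, (orderStat z j - windowMean m z i) ^ 2 =
        D ^ 2 * ((j : ℝ) - i) ^ 2 + 2 * D * (e j * (j - i)) - 2 * D * E * (j - i)
          + (e j - E) ^ 2 := fun j => by
      rw [hmean, ho j]; ring
    simp_rw [h1]
    rw [Finset.sum_add_distrib, Finset.sum_sub_distrib, Finset.sum_add_distrib, ← Finset.mul_sum,
      ← Finset.mul_sum, ← Finset.mul_sum, hW, sum_window_sub, ← hW]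
    ring
  have hDQ : 0 < D ^ 2 * Q := by positivity
  have hDA : |D * A| ≤ 3 * ε * (D ^ 2 * Q) := by
    rw [abs_mul, abs_of_pos hD]
    calc D * |A| ≤ D * (3 * ε * (D * Q)) := by gcongr
      _ = _ := by ring
  have hRb' : R ≤ ε * (D ^ 2 * Q) := by
    refine hRb.trans ?_
    nlinarith [mul_nonneg hε0 hDQ.le]
  have hSlow : D ^ 2 * Q / 2 ≤ D ^ 2 * Q + 2 * D * A + R := by
    have := (abs_le.1 hDA).1
    nlinarith
  have hSpos : 0 < D ^ 2 * Q + 2 * D * A + R := by linarith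
  unfold localSlope
  rw [← hW, hN, hS]
  -- The relative error is `-(D A + R) / S`. Its numerator is at most `4 ε D² Q` and `S ≥ D² Q / 2`,
  -- so the constant `50` is generous.
  have hdiff : (D * Q + A) / (n * (D ^ 2 * Q + 2 * D * A + R)) - 1 / (n * D) =
      -(D * A + R) / (D ^ 2 * Q + 2 * D * A + R) * (1 / (n * D)) := by
    have hDS : D * (D * Q + A) = (D ^ 2 * Q + 2 * D * A + R) - (D * A + R) := by ring
    generalize D ^ 2 * Q + 2 * D * A + R = S at hSpos hDS
    field_simp
    linear_combination hDS
  rw [hdiff, abs_mul, abs_of_pos (show 0 < 1 / (n * D) by positivity), abs_div, abs_neg,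
    abs_of_pos hSpos]
  refine mul_le_mul_of_nonneg_right ?_ (by positivity)
  rw [div_le_iff₀ hSpos]
  have h1 : |D * A + R| ≤ 4 * ε * (D ^ 2 * Q) := by
    refine (abs_add_le _ _).trans ?_
    rw [abs_of_nonneg hR0]
    linarith
  nlinarith [mul_nonneg hε0 hDQ.le, mul_le_mul_of_nonneg_left hSlow hε0]

/-- If the empirical counts near `x` follow the straight line of slope `d` at the points of a
grid of mesh `1 / K`, then the order statistics in the window are nearly equally spaced. -/
lemma abs_orderStat_sub_le {n : ℕ} (z : Fin n → ℝ) {m : ℕ} (hm : 0 < m) (i : ℤ)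
    {x δ : ℝ} (hδ : 0 < δ) {K : ℕ} (hK : 0 < K)
    (h : ∀ q ∈ Finset.Icc (-(K + 2) : ℤ) (K + 2),
      |((Finset.univ.filter fun a => z a ≤ x + q / K * δ).card : ℝ) - i - q / K * m| ≤ m / K) :
    ∀ j ∈ Finset.Icc (i - m) (i + m),
      |orderStat z j - x - δ / m * (j - i)| ≤ 2 / K * (δ / m * m) := by
  have hm' : (0 : ℝ) < m := by exact_mod_cast hm
  have hK' : (0 : ℝ) < K := by exact_mod_cast hK
  have hmK : 0 < (m : ℝ) / K := by positivity
  -- The outermost grid points overshoot the window by `2 m / K` ranks while the counts err by at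
  -- most `m / K`; hence the window lies inside `[1, n]` and no index is clamped.
  have hi1 : m < i := by
    have h1 := abs_le.1 (h (-(K + 2)) (by simp [Finset.mem_Icc]; omega))
    have h2 : (0 : ℝ) ≤
      ((Finset.univ.filter fun a => z a ≤ x + (-(K + 2) : ℤ) / K * δ).card : ℝ) := by positivity
    have h3 : ((-(K + 2) : ℤ) : ℝ) / K * m = -m - 2 * (m / K) := by
      push_cast; field_simp; ring
    rw [h3] at h1
    have : (m : ℝ) < i := by linarith [h1.1, h1.2]
    exact_mod_cast this
  have hi2 : i + m < n := by
    have h1 := abs_le.1 (h (K + 2) (by simp [Finset.mem_Icc]; omega))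
    have h2 : ((Finset.univ.filter fun a => z a ≤ x + (K + 2 : ℤ) / K * δ).card : ℝ) ≤ n := by
      have := Finset.card_le_univ (Finset.univ.filter fun a => z a ≤ x + (K + 2 : ℤ) / K * δ)
      rw [Fintype.card_fin] at this
      exact_mod_cast this
    have h3 : ((K + 2 : ℤ) : ℝ) / K * m = m + 2 * (m / K) := by
      push_cast; field_simp
    rw [h3] at h1
    have : (i : ℝ) + m < n := by linarith [h1.1, h1.2]
    exact_mod_cast this
  intro j hj
  rw [Finset.mem_Icc] at hj
  set s : ℝ := (j : ℝ) - i with hs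
  have hs1 : -(m : ℝ) ≤ s := by
    have : ((i - m : ℤ) : ℝ) ≤ j := by exact_mod_cast hj.1
    push_cast at this; linarith
  have hs2 : s ≤ m := by
    have : (j : ℝ) ≤ ((i + m : ℤ) : ℝ) := by exact_mod_cast hj.2
    push_cast at this; linarith
  -- The offset `s` lies in `((c - 1) m / K, c m / K]`. One more mesh absorbs the count error, so
  -- `orderStat z j` lies between the grid points `c - 2` and `c + 1`.
  set c : ℤ := ⌈(K : ℝ) * s / m⌉ with hc
  have hc1 : (K : ℝ) * s / m ≤ c := Int.le_ceil _
  have hc2 : (c : ℝ) < K * s / m + 1 := Int.ceil_lt_add_one _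
  have hsm : (K : ℝ) * s / m * m = K * s := by field_simp
  have hcK : c ≤ K := Int.ceil_le.2 (by
    rw [div_le_iff₀ hm']; push_cast; exact mul_le_mul_of_nonneg_left hs2 hK'.le)
  have hcK' : -(K : ℤ) ≤ c := by
    have : (-(K : ℤ) : ℝ) ≤ c := by
      refine le_trans ?_ hc1
      rw [le_div_iff₀ hm']; push_cast; nlinarith
    exact_mod_cast this
  have hup : orderStat z j ≤ x + (c + 1 : ℤ) / K * δ := by
    rw [orderStat_le_iff z (by omega) (by omega)]
    have h1 := (abs_le.1 (h (c + 1) (by simp [Finset.mem_Icc]; omega))).1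
    have h2 : ((c + 1 : ℤ) : ℝ) / K * m = c * m / K + m / K := by push_cast; field_simp
    have h3 : s ≤ c * m / K := by
      rw [le_div_iff₀ hK']
      nlinarith [mul_le_mul_of_nonneg_right hc1 hm'.le]
    have h4 : (j : ℝ) ≤ (Finset.univ.filter fun a => z a ≤ x + (c + 1 : ℤ) / K * δ).card := by
      rw [h2] at h1; linarith
    exact_mod_cast h4
  have hlo : x + (c - 2 : ℤ) / K * δ < orderStat z j := by
    rw [← not_le, orderStat_le_iff z (by omega) (by omega), not_le]
    have h1 := (abs_le.1 (h (c - 2) (by simp [Finset.mem_Icc]; omega))).2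
    have h2 : ((c - 2 : ℤ) : ℝ) / K * m = (c - 1) * m / K - m / K := by
      push_cast; field_simp; ring
    have h3 : (c - 1) * m / K < s := by
      rw [div_lt_iff₀ hK']
      nlinarith [mul_lt_mul_of_pos_right hc2 hm']
    have h4 : ((Finset.univ.filter fun a => z a ≤ x + (c - 2 : ℤ) / K * δ).card : ℝ) < j := by
      rw [h2] at h1; linarith
    exact_mod_cast h4
  have e1 : δ / m * m = δ := by field_simp
  have e2 : δ / m * s = (K * s / m) / K * δ := by field_simp
  rw [e1, e2, abs_le]
  push_cast at hup hlo
  have b1 : ((c : ℝ) + 1) / K * δ ≤ (K * s / m) / K * δ + 2 / K * δ := by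
    rw [← add_mul, ← add_div]
    have : (c : ℝ) + 1 ≤ K * s / m + 2 := by linarith
    gcongr
  have b2 : (K * s / m) / K * δ - 2 / K * δ ≤ ((c : ℝ) - 2) / K * δ := by
    rw [← sub_mul, ← sub_div]; gcongr
  constructor <;> linarith

end Regression

/-! ### The maximal function of the law -/

section MaximalFunction

open Metric
open scoped ENNReal

/-- The centered Hardy–Littlewood maximal function of a measure on the line (normalized by the
radii of the intervals, which are taken rational). -/
def maximalFunction (μ : Measure ℝ) (x : ℝ) : ℝ≥0∞ :=
  ⨆ q : {q : ℚ // 0 < q}, μ (closedBall x (q : ℚ)) / ENNReal.ofReal (q : ℚ)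

lemma measurable_maximalFunction (μ : Measure ℝ) [SFinite μ] :
    Measurable (maximalFunction μ) := by
  refine Measurable.iSup fun q => Measurable.div_const ?_ _
  have hS : MeasurableSet {p : ℝ × ℝ | dist p.2 p.1 ≤ (q : ℚ)} :=
    (isClosed_le (by fun_prop) (by fun_prop)).measurableSet
  exact measurable_measure_prodMk_left hS

lemma measure_closedBall_le_maximalFunction (μ : Measure ℝ) (x : ℝ) {r : ℝ} (hr : 0 < r) :
    μ (closedBall x r) ≤ ENNReal.ofReal (2 * r) * maximalFunction μ x := by
  obtain ⟨q, hq1, hq2⟩ := exists_rat_btwn (show r < 2 * r by linarith)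
  have hq0 : 0 < q := by exact_mod_cast hr.trans hq1
  have hq0' : (0 : ℝ) < q := hr.trans hq1
  have h1 : μ (closedBall x q) / ENNReal.ofReal q ≤ maximalFunction μ x :=
    le_iSup (fun q : {q : ℚ // 0 < q} => μ (closedBall x (q : ℚ)) / ENNReal.ofReal (q : ℚ))
      ⟨q, hq0⟩
  rw [ENNReal.div_le_iff (by simpa using hq0') ENNReal.ofReal_ne_top] at h1
  calc μ (closedBall x r) ≤ μ (closedBall x q) := measure_mono (closedBall_subset_closedBall hq1.le)
    _ ≤ maximalFunction μ x * ENNReal.ofReal q := h1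
    _ ≤ ENNReal.ofReal (2 * r) * maximalFunction μ x := by
      rw [mul_comm]; gcongr

variable {μ : Measure ℝ} {f : ℝ → ℝ}

/-- Where `f ≤ t / 4` the ball carries mass at most `(t / 4) (2 r)`, half of the assumed mass.
Keeping only large values of `f` is what lets the weak estimate integrate to a strong one. -/
lemma ofReal_le_measure_closedBall_inter (hf : Measurable f)
    (hμ : μ = volume.withDensity fun x => ENNReal.ofReal (f x)) {x r t : ℝ} (hr : 0 < r)
    (ht : 0 < t) (h : ENNReal.ofReal (t * r) ≤ μ (closedBall x r)) :
    ENNReal.ofReal (t * r / 2) ≤ μ (closedBall x r ∩ {y | t < 4 * f y}) := by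
  have hS : MeasurableSet {y | t < 4 * f y} := measurableSet_lt measurable_const (hf.const_mul 4)
  have hB : MeasurableSet (closedBall x r) := measurableSet_closedBall
  have h1 : μ (closedBall x r \ {y | t < 4 * f y}) ≤ ENNReal.ofReal (t * r / 2) := by
    rw [hμ, withDensity_apply _ (hB.diff hS)]
    calc ∫⁻ y in closedBall x r \ {y | t < 4 * f y}, ENNReal.ofReal (f y)
        ≤ ∫⁻ _y in closedBall x r \ {y | t < 4 * f y}, ENNReal.ofReal (t / 4) := by
          refine setLIntegral_mono measurable_const fun y hy => ?_
          refine ENNReal.ofReal_le_ofReal ?_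
          have : 4 * f y ≤ t := not_lt.1 hy.2
          linarith
      _ = ENNReal.ofReal (t / 4) * volume (closedBall x r \ {y | t < 4 * f y}) := by
          rw [setLIntegral_const]
      _ ≤ ENNReal.ofReal (t / 4) * volume (closedBall x r) := by
          gcongr; exact Set.sdiff_subset
      _ = ENNReal.ofReal (t * r / 2) := by
          rw [Real.volume_closedBall, ← ENNReal.ofReal_mul (by positivity)]; congr 1; ring
  have h2 : ENNReal.ofReal (t * r / 2) + ENNReal.ofReal (t * r / 2) ≤
      μ (closedBall x r ∩ {y | t < 4 * f y}) + ENNReal.ofReal (t * r / 2) := by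
    calc ENNReal.ofReal (t * r / 2) + ENNReal.ofReal (t * r / 2) = ENNReal.ofReal (t * r) := by
          rw [← ENNReal.ofReal_add (by positivity) (by positivity)]; congr 1; ring
      _ ≤ μ (closedBall x r) := h
      _ = μ (closedBall x r ∩ {y | t < 4 * f y}) + μ (closedBall x r \ {y | t < 4 * f y}) :=
          (measure_inter_add_sdiff _ hS).symm
      _ ≤ _ := by gcongr
  exact (ENNReal.add_le_add_iff_right ENNReal.ofReal_ne_top).1 h2

/-- The weak type estimate for the maximal function, in truncated form. -/
lemma volume_lt_maximalFunction_le [IsProbabilityMeasure μ] (hf : Measurable f)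
    (hμ : μ = volume.withDensity fun x => ENNReal.ofReal (f x)) {t : ℝ} (ht : 0 < t) :
    volume {x | ENNReal.ofReal t < maximalFunction μ x} ≤
      ENNReal.ofReal (16 / t) * μ {x | t < 4 * f x} := by
  have hS : MeasurableSet {y | t < 4 * f y} := measurableSet_lt measurable_const (hf.const_mul 4)
  have hex : ∀ x ∈ {x | ENNReal.ofReal t < maximalFunction μ x},
      ∃ r : ℝ, 0 < r ∧ ENNReal.ofReal (t * r) ≤ μ (closedBall x r) := by
    intro x hx
    have hx' : ENNReal.ofReal t < maximalFunction μ x := hx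
    obtain ⟨q, hq⟩ := lt_iSup_iff.1 hx'
    have hq0 : (0 : ℝ) < (q : ℚ) := by exact_mod_cast q.2
    refine ⟨(q : ℚ), hq0, ?_⟩
    rw [ENNReal.lt_div_iff_mul_lt (Or.inl (by simpa using hq0)) (Or.inl ENNReal.ofReal_ne_top)]
      at hq
    rw [ENNReal.ofReal_mul ht.le]
    exact hq.le
  choose! r hr0 hr using hex
  -- Total mass one bounds the radii by `1 / t`, as Vitali covering requires. Enlargement by `4`
  -- gives length `8 r = (16 / t) (t r / 2)`.
  obtain ⟨u, hut, hdisj, hcov⟩ := Vitali.exists_disjoint_subfamily_covering_enlargement_closedBall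
    {x | ENNReal.ofReal t < maximalFunction μ x} (fun x => x) r (1 / t) (by
      intro x hx
      have h1 := (hr x hx).trans prob_le_one
      rw [ENNReal.ofReal_le_one] at h1
      rw [le_div_iff₀ ht]; linarith) 4 (by norm_num)
  have hucount : u.Countable := hdisj.countable_of_nonempty_interior fun x hx =>
    ⟨x, mem_interior_iff_mem_nhds.2 (closedBall_mem_nhds x (hr0 x (hut hx)))⟩
  calc volume {x | ENNReal.ofReal t < maximalFunction μ x}
      ≤ volume (⋃ x ∈ u, closedBall x (4 * r x)) := by
        refine measure_mono fun x hx => ?_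
        obtain ⟨b, hb, hsub⟩ := hcov x hx
        exact Set.mem_biUnion hb (hsub (mem_closedBall_self (hr0 x hx).le))
    _ ≤ ∑' x : u, volume (closedBall (x : ℝ) (4 * r x)) := measure_biUnion_le _ hucount _
    _ ≤ ∑' x : u, ENNReal.ofReal (16 / t) * μ (closedBall (x : ℝ) (r x) ∩ {y | t < 4 * f y}) := by
        refine ENNReal.tsum_le_tsum fun x => ?_
        have hx := hut x.2
        have h1 := ofReal_le_measure_closedBall_inter hf hμ (hr0 _ hx) ht (hr _ hx)
        calc volume (closedBall (x : ℝ) (4 * r x))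
            = ENNReal.ofReal (16 / t) * ENNReal.ofReal (t * r x / 2) := by
              rw [Real.volume_closedBall, ← ENNReal.ofReal_mul (by positivity)]
              congr 1; field_simp; ring
          _ ≤ _ := by gcongr
    _ = ENNReal.ofReal (16 / t) * ∑' x : u, μ (closedBall (x : ℝ) (r x) ∩ {y | t < 4 * f y}) :=
        ENNReal.tsum_mul_left
    _ = ENNReal.ofReal (16 / t) * μ (⋃ x ∈ u, closedBall x (r x) ∩ {y | t < 4 * f y}) := by
        rw [measure_biUnion hucount]
        · intro a ha b hb hab
          exact (hdisj ha hb hab).mono Set.inter_subset_left Set.inter_subset_left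
        · exact fun x _ => measurableSet_closedBall.inter hS
    _ ≤ _ := by
        gcongr
        exact Set.iUnion₂_subset fun x _ => Set.inter_subset_right

/-- Let `t → ∞` in the weak estimate. Later bounds use `toReal`, which would send an infinite value
to zero. -/
lemma ae_maximalFunction_lt_top [IsProbabilityMeasure μ] (hf : Measurable f)
    (hμ : μ = volume.withDensity fun x => ENNReal.ofReal (f x)) :
    ∀ᵐ x, maximalFunction μ x < ∞ := by
  have h0 : volume {x | maximalFunction μ x = ∞} = 0 := by
    refine le_antisymm ?_ bot_le
    have hlim : Tendsto (fun t : ℝ => ENNReal.ofReal (16 / t)) atTop (nhds 0) := by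
      have : Tendsto (fun t : ℝ => 16 / t) atTop (nhds 0) := tendsto_const_nhds.div_atTop tendsto_id
      simpa using ENNReal.tendsto_ofReal this
    refine ge_of_tendsto hlim ?_
    filter_upwards [eventually_gt_atTop 0] with t ht
    calc volume {x | maximalFunction μ x = ∞}
        ≤ volume {x | ENNReal.ofReal t < maximalFunction μ x} := by
          refine measure_mono fun x hx => ?_
          have hx' : maximalFunction μ x = ∞ := hx
          change ENNReal.ofReal t < maximalFunction μ x
          rw [hx']
          exact ENNReal.ofReal_lt_top
      _ ≤ _ := volume_lt_maximalFunction_le hf hμ ht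
      _ ≤ ENNReal.ofReal (16 / t) * 1 := by gcongr; exact prob_le_one
      _ = _ := mul_one _
  rw [ae_iff]
  simpa [not_lt, top_le_iff] using h0

/-- The strong type estimate for the maximal function in `L³`. -/
lemma lintegral_maximalFunction_cube_le [IsProbabilityMeasure μ] (hf : Measurable f)
    (hf0 : ∀ x, 0 ≤ f x) (hμ : μ = volume.withDensity fun x => ENNReal.ofReal (f x)) :
    ∫⁻ x, ENNReal.ofReal ((maximalFunction μ x).toReal ^ 3) ≤
      384 * ∫⁻ x, ENNReal.ofReal (f x ^ 2) ∂μ := by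
  have hM := (measurable_maximalFunction μ).ennreal_toReal
  have h1 := lintegral_rpow_eq_lintegral_meas_lt_mul volume
    (ae_of_all _ fun x => ENNReal.toReal_nonneg) hM.aemeasurable (p := (3 : ℕ)) (by norm_num)
  have h2 := lintegral_rpow_eq_lintegral_meas_lt_mul μ (f := fun x => 4 * f x)
    (ae_of_all _ fun x => mul_nonneg (by norm_num) (hf0 x)) (hf.const_mul 4).aemeasurable
    (p := (2 : ℕ)) (by norm_num)
  simp_rw [Real.rpow_natCast] at h1 h2
  rw [h1]
  -- The weak bound `16 / t` lowers the layer-cake weight from `t²` to `t`, so the cube for Lebesgue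
  -- measure is controlled by the square for `μ`. The constant is `384 = (3 / 2) · 16 · 4²`.
  have h3 : ∫⁻ t in Set.Ioi (0 : ℝ), volume {x | t < (maximalFunction μ x).toReal} *
      ENNReal.ofReal (t ^ (((3 : ℕ) : ℝ) - 1)) ≤
      16 * ∫⁻ t in Set.Ioi (0 : ℝ), μ {x | t < 4 * f x} *
        ENNReal.ofReal (t ^ (((2 : ℕ) : ℝ) - 1)) := by
    rw [← lintegral_const_mul' _ _ (by norm_num)]
    refine setLIntegral_mono' measurableSet_Ioi fun t ht => ?_
    have ht' : 0 < t := ht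
    have hpow : ENNReal.ofReal (16 / t) * ENNReal.ofReal (t ^ (((3 : ℕ) : ℝ) - 1)) =
        16 * ENNReal.ofReal (t ^ (((2 : ℕ) : ℝ) - 1)) := by
      rw [← ENNReal.ofReal_mul (by positivity),
        show (16 : ℝ≥0∞) = ENNReal.ofReal 16 by norm_num, ← ENNReal.ofReal_mul (by norm_num)]
      congr 1
      rw [show (((3 : ℕ) : ℝ) - 1) = ((2 : ℕ) : ℝ) by norm_num,
        show (((2 : ℕ) : ℝ) - 1) = ((1 : ℕ) : ℝ) by norm_num, Real.rpow_natCast,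
        Real.rpow_natCast]
      field_simp
    calc volume {x | t < (maximalFunction μ x).toReal} *
          ENNReal.ofReal (t ^ (((3 : ℕ) : ℝ) - 1))
        ≤ (ENNReal.ofReal (16 / t) * μ {x | t < 4 * f x}) *
          ENNReal.ofReal (t ^ (((3 : ℕ) : ℝ) - 1)) := by
          gcongr
          refine (measure_mono fun x hx => ?_).trans (volume_lt_maximalFunction_le hf hμ ht')
          have hx' : t < (maximalFunction μ x).toReal := hx
          have hne : maximalFunction μ x ≠ ∞ := by
            intro h
            rw [h] at hx'
            simp at hx'
            linarith
          exact (ENNReal.ofReal_lt_iff_lt_toReal ht'.le hne).2 hx'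
      _ = (ENNReal.ofReal (16 / t) * ENNReal.ofReal (t ^ (((3 : ℕ) : ℝ) - 1))) *
          μ {x | t < 4 * f x} := by ring
      _ = _ := by rw [hpow]; ring
  have h4 : ∫⁻ x, ENNReal.ofReal ((4 * f x) ^ 2) ∂μ =
      16 * ∫⁻ x, ENNReal.ofReal (f x ^ 2) ∂μ := by
    rw [← lintegral_const_mul' _ _ (by norm_num)]
    refine lintegral_congr fun x => ?_
    rw [show (16 : ℝ≥0∞) = ENNReal.ofReal 16 by norm_num, ← ENNReal.ofReal_mul (by norm_num)]
    congr 1; ring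
  set I := ∫⁻ t in Set.Ioi (0 : ℝ), μ {x | t < 4 * f x} *
        ENNReal.ofReal (t ^ (((2 : ℕ) : ℝ) - 1))
  calc _ ≤ ENNReal.ofReal ((3 : ℕ) : ℝ) * (16 * I) := by gcongr
    _ = 24 * (ENNReal.ofReal ((2 : ℕ) : ℝ) * I) := by
      rw [ENNReal.ofReal_natCast, ENNReal.ofReal_natCast]
      push_cast; ring
    _ = _ := by rw [← h2, h4]; ring

/-- With `M` the maximal function, `M² f ≤ M³ + f³` pointwise, and the strong estimate bounds `∫ M³`
by a multiple of `∫ f² dμ = ∫ f³`. -/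
lemma lintegral_maximalFunction_sq_lt_top [IsProbabilityMeasure μ] (hf : Measurable f)
    (hf0 : ∀ x, 0 ≤ f x) (hμ : μ = volume.withDensity fun x => ENNReal.ofReal (f x))
    (hf3 : Integrable (fun x => f x ^ 3)) :
    ∫⁻ x, ENNReal.ofReal ((maximalFunction μ x).toReal ^ 2) ∂μ < ∞ ∧
      ∫⁻ x, ENNReal.ofReal (f x ^ 2) ∂μ < ∞ := by
  have hM := (measurable_maximalFunction μ).ennreal_toReal
  have hfi : ∫⁻ x, ENNReal.ofReal (f x ^ 3) < ∞ := hf3.lintegral_lt_top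
  have hf2 : ∫⁻ x, ENNReal.ofReal (f x ^ 2) ∂μ < ∞ := by
    rw [hμ, lintegral_withDensity_eq_lintegral_mul _ hf.ennreal_ofReal (by fun_prop)]
    refine lt_of_eq_of_lt (lintegral_congr fun x => ?_) hfi
    rw [Pi.mul_apply, ← ENNReal.ofReal_mul (hf0 x)]
    congr 1; ring
  refine ⟨?_, hf2⟩
  have hM3 := lintegral_maximalFunction_cube_le hf hf0 hμ
  generalize hg : (fun x => (maximalFunction μ x).toReal) = g at *
  have hg' : ∀ x, (maximalFunction μ x).toReal = g x := fun x => congrFun hg x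
  have hg0 : ∀ x, 0 ≤ g x := fun x => by rw [← hg']; exact ENNReal.toReal_nonneg
  simp_rw [hg'] at hM3 ⊢
  rw [hμ, lintegral_withDensity_eq_lintegral_mul _ hf.ennreal_ofReal (by fun_prop)]
  calc ∫⁻ x, ((fun x => ENNReal.ofReal (f x)) * fun x => ENNReal.ofReal (g x ^ 2)) x
      ≤ ∫⁻ x, (ENNReal.ofReal (g x ^ 3) + ENNReal.ofReal (f x ^ 3)) := by
        refine lintegral_mono fun x => ?_
        have h1 := hg0 x
        have h2 := hf0 x
        simp only [Pi.mul_apply]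
        rw [← ENNReal.ofReal_mul (hf0 x), ← ENNReal.ofReal_add (by positivity) (by positivity)]
        refine ENNReal.ofReal_le_ofReal ?_
        rcases le_total (f x) (g x) with h | h
        · nlinarith [mul_le_mul_of_nonneg_right h (sq_nonneg (g x)), pow_nonneg h2 3]
        · nlinarith [mul_le_mul_of_nonneg_left (pow_le_pow_left₀ h1 h 2) h2, pow_nonneg h1 3]
    _ = (∫⁻ x, ENNReal.ofReal (g x ^ 3)) + ∫⁻ x, ENNReal.ofReal (f x ^ 3) :=
        lintegral_add_left (by fun_prop) _
    _ < ∞ := ENNReal.add_lt_top.2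
        ⟨hM3.trans_lt (ENNReal.mul_lt_top (by norm_num) hf2), hfi⟩

end MaximalFunction

/-! ### Measurability, and isolating one sample point -/

section Measurability

/-- The sorting permutation is determined by finitely many comparisons of coordinates, including the
rule for ties. -/
lemma measurableSet_sort_eq {n : ℕ} (σ : Equiv.Perm (Fin n)) :
    MeasurableSet {z : Fin n → ℝ | Tuple.sort z = σ} := by
  have h : {z : Fin n → ℝ | Tuple.sort z = σ} =
      (⋂ i, ⋂ j, ⋂ _ : i ≤ j, {z : Fin n → ℝ | z (σ i) ≤ z (σ j)}) ∩
        ⋂ i, ⋂ j, ⋂ _ : i < j, ⋂ _ : ¬ σ i < σ j, {z : Fin n → ℝ | z (σ i) = z (σ j)}ᶜ := by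
    ext z
    have h1 : z ∈ {z : Fin n → ℝ | Tuple.sort z = σ} ↔ σ = Tuple.sort z := by
      rw [Set.mem_ofPred_eq]; exact eq_comm
    rw [h1, Tuple.eq_sort_iff]
    simp only [Set.mem_inter_iff, Set.mem_iInter, Set.mem_compl_iff, Set.mem_ofPred_eq]
    refine and_congr (by simp [Monotone]) ?_
    refine forall_congr' fun i => forall_congr' fun j => forall_congr' fun _ => ?_
    tauto
  rw [h]
  refine MeasurableSet.inter ?_ ?_
  · refine MeasurableSet.iInter fun i => MeasurableSet.iInter fun j => MeasurableSet.iInter fun _ => ?_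
    exact measurableSet_le (measurable_pi_apply _) (measurable_pi_apply _)
  · refine MeasurableSet.iInter fun i => MeasurableSet.iInter fun j => MeasurableSet.iInter fun _ =>
      MeasurableSet.iInter fun _ => MeasurableSet.compl ?_
    exact measurableSet_eq_fun (measurable_pi_apply _) (measurable_pi_apply _)

lemma measurable_comp_sort {n : ℕ} (φ : Equiv.Perm (Fin n) → (Fin n → ℝ) → ℝ)
    (hφ : ∀ σ, Measurable (φ σ)) : Measurable fun z => φ (Tuple.sort z) z := by
  have h : (fun z => φ (Tuple.sort z) z) =
      fun z => ∑ σ, Set.indicator {z : Fin n → ℝ | Tuple.sort z = σ} (φ σ) z := by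
    funext z
    rw [Finset.sum_eq_single (Tuple.sort z)]
    · exact (Set.indicator_of_mem
        (show z ∈ {w : Fin n → ℝ | Tuple.sort w = Tuple.sort z} from rfl) _).symm
    · intro σ _ hσ
      have hz : z ∉ {w : Fin n → ℝ | Tuple.sort w = σ} := fun h => hσ (Eq.symm h)
      exact Set.indicator_of_notMem hz _
    · simp
  rw [h]
  exact Finset.measurable_sum _ fun σ _ => (hφ σ).indicator (measurableSet_sort_eq σ)

lemma measurable_orderStat {n : ℕ} (j : ℤ) : Measurable fun z : Fin n → ℝ => orderStat z j := by
  by_cases h : 0 < n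
  · simp only [orderStat, dif_pos h]
    exact measurable_comp_sort (fun σ z => z (σ ⟨(max 1 (min j n) - 1).toNat, by omega⟩))
      fun σ => measurable_pi_apply _
  · simp only [orderStat, dif_neg h]
    exact measurable_const

lemma measurable_localSlope {n : ℕ} (m : ℕ) (i : ℤ) :
    Measurable fun z : Fin n → ℝ => localSlope m z i := by
  have h1 : ∀ j, Measurable fun z : Fin n → ℝ => orderStat z j := measurable_orderStat
  have h2 : Measurable fun z : Fin n → ℝ => windowMean m z i := by
    unfold windowMean
    exact (Finset.measurable_sum _ fun j _ => h1 j).const_mul _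
  unfold localSlope
  refine Measurable.div ?_ (Measurable.const_mul ?_ _)
  · exact Finset.measurable_sum _ fun j _ => ((h1 j).sub h2).mul_const _
  · exact Finset.measurable_sum _ fun j _ => ((h1 j).sub h2).pow_const 2

lemma measurable_localSlope_sampleRank {n : ℕ} (m : ℕ) (l : Fin n) :
    Measurable fun z : Fin n → ℝ => localSlope m z (sampleRank z l) :=
  measurable_comp_sort (fun σ z => localSlope m z ((σ.symm l : Fin n) + 1 : ℤ))
    fun _ => measurable_localSlope m _

/-- The local slope at the `l`-th sample point, when this point is `x` and the others are `y`. -/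
def slopeAt (m : ℕ) {N : ℕ} (l : Fin (N + 1)) (x : ℝ) (y : Fin N → ℝ) : ℝ :=
  localSlope m (l.insertNth (α := fun _ => ℝ) x y)
    (sampleRank (l.insertNth (α := fun _ => ℝ) x y) l)

lemma measurable_slopeAt (m : ℕ) {N : ℕ} (l : Fin (N + 1)) :
    Measurable fun p : ℝ × (Fin N → ℝ) => slopeAt m l p.1 p.2 := by
  have h : Measurable fun p : ℝ × (Fin N → ℝ) => l.insertNth (α := fun _ => ℝ) p.1 p.2 := by
    refine measurable_pi_iff.2 (l.forall_iff_succAbove.2 ⟨?_, fun a => ?_⟩)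
    · simpa using measurable_fst
    · simp only [Fin.insertNth_apply_succAbove]
      fun_prop
  unfold slopeAt
  exact (measurable_localSlope_sampleRank m l).comp h

lemma measurable_slopeAt_right (m : ℕ) {N : ℕ} (l : Fin (N + 1)) (x : ℝ) :
    Measurable (slopeAt m l x) := by
  have h : Measurable fun y : Fin N → ℝ => (x, y) := measurable_prodMk_left
  have := (measurable_slopeAt m l).comp h
  simpa only [Function.comp_def] using this

lemma card_filter_insertNth {N : ℕ} (l : Fin (N + 1)) (x : ℝ) (y : Fin N → ℝ) (p : ℝ → Prop)
    [DecidablePred p] :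
    (Finset.univ.filter fun a => p (l.insertNth (α := fun _ => ℝ) x y a)).card =
      (if p x then 1 else 0) + (Finset.univ.filter fun a => p (y a)).card := by
  rw [Finset.card_filter, Finset.card_filter, Fin.sum_univ_succAbove _ l]
  simp

end Measurability

/-! ### Tail bounds for empirical counts -/

section Counting

variable {μ : Measure ℝ} [IsProbabilityMeasure μ]

/-- It is unlikely that many sample points fall into a set of small measure. -/
lemma measure_le_card_le (N : ℕ) {k : ℕ} (hk : 0 < k) (p : ℝ → Prop) [DecidablePred p] :
    Measure.pi (fun _ : Fin N => μ) {y | k ≤ (Finset.univ.filter fun a => p (y a)).card} ≤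
      ENNReal.ofReal ((Real.exp 1 * (N * μ.real {x | p x} / k)) ^ k) := by
  -- Union bound over the `k`-subsets that may lie in the set; then `N.choose k ≤ N ^ k / k!` and `k
  -- ^ k / k! ≤ exp k`.
  have hsub : {y : Fin N → ℝ | k ≤ (Finset.univ.filter fun a => p (y a)).card} ⊆
      ⋃ S ∈ Finset.powersetCard k (Finset.univ : Finset (Fin N)),
        Set.pi Set.univ fun a => if a ∈ S then {x | p x} else Set.univ := by
    intro y hy
    have hy' : k ≤ (Finset.univ.filter fun a => p (y a)).card := hy
    obtain ⟨S, hS, hc⟩ := Finset.exists_subset_card_eq hy'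
    refine Set.mem_biUnion (Finset.mem_powersetCard.2 ⟨Finset.subset_univ _, hc⟩) ?_
    intro a _
    by_cases ha : a ∈ S
    · simp only [ha, if_true]
      exact (Finset.mem_filter.1 (hS ha)).2
    · simp [ha]
  have hk' : (0 : ℝ) < k := by exact_mod_cast hk
  have hp0 : 0 ≤ μ.real {x | p x} := measureReal_nonneg
  calc Measure.pi (fun _ : Fin N => μ) {y | k ≤ (Finset.univ.filter fun a => p (y a)).card}
      ≤ ∑ S ∈ Finset.powersetCard k (Finset.univ : Finset (Fin N)),
          Measure.pi (fun _ : Fin N => μ)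
            (Set.pi Set.univ fun a => if a ∈ S then {x | p x} else Set.univ) :=
        (measure_mono hsub).trans (measure_biUnion_finset_le _ _)
    _ = ∑ S ∈ Finset.powersetCard k (Finset.univ : Finset (Fin N)),
          ENNReal.ofReal (μ.real {x | p x} ^ k) := by
        refine Finset.sum_congr rfl fun S hS => ?_
        rw [Measure.pi_pi, ENNReal.ofReal_pow hp0, ofReal_measureReal,
          ← (Finset.mem_powersetCard.1 hS).2]
        have : ∀ a, μ (if a ∈ S then {x | p x} else Set.univ) =
            if a ∈ S then μ {x | p x} else 1 := fun a => by split_ifs <;> simp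
        simp_rw [this, Finset.prod_ite_mem, Finset.univ_inter, Finset.prod_const]
    _ = ENNReal.ofReal (N.choose k * μ.real {x | p x} ^ k) := by
        rw [Finset.sum_const, Finset.card_powersetCard, Finset.card_univ, Fintype.card_fin,
          nsmul_eq_mul, ENNReal.ofReal_mul (by positivity), ENNReal.ofReal_natCast]
    _ ≤ _ := by
        refine ENNReal.ofReal_le_ofReal ?_
        have h1 : (N.choose k : ℝ) ≤ N ^ k / k.factorial := Nat.choose_le_pow_div k N
        have h2 : (k : ℝ) ^ k / k.factorial ≤ Real.exp k :=
          Real.pow_div_factorial_le_exp _ hk'.le k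
        have h3 : Real.exp k = Real.exp 1 ^ k := by rw [← Real.exp_nat_mul, mul_one]
        calc (N.choose k : ℝ) * μ.real {x | p x} ^ k
            ≤ N ^ k / k.factorial * μ.real {x | p x} ^ k := by gcongr
          _ = (k : ℝ) ^ k / k.factorial * (N * μ.real {x | p x} / k) ^ k := by
              rw [div_pow, mul_pow]; field_simp
          _ ≤ Real.exp k * (N * μ.real {x | p x} / k) ^ k := by gcongr
          _ = _ := by rw [h3, mul_pow]

/-- Chebyshev's inequality for the number of sample points in a set. -/
lemma measure_le_abs_card_sub_le (N : ℕ) (p : ℝ → Prop) [DecidablePred p]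
    (hp : MeasurableSet {x | p x}) {η : ℝ} (hη : 0 < η) :
    Measure.pi (fun _ : Fin N => μ)
      {y | η ≤ |((Finset.univ.filter fun a => p (y a)).card : ℝ) - N * μ.real {x | p x}|} ≤
      ENNReal.ofReal (N * μ.real {x | p x} / η ^ 2) := by
  set g : ℝ → ℝ := Set.indicator {x | p x} 1 with hg
  have hgm : Measurable g := measurable_one.indicator hp
  have hgL : MemLp g 2 μ := (memLp_const (1 : ℝ)).indicator hp
  have hgi : ∫ x, g x ∂μ = μ.real {x | p x} := integral_indicator_one hp
  set X : (Fin N → ℝ) → ℝ := ∑ a : Fin N, fun y : Fin N → ℝ => g (y a) with hX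
  have hcard : ∀ y, X y = ((Finset.univ.filter fun a => p (y a)).card : ℝ) := by
    intro y
    rw [hX, Finset.sum_apply, Finset.card_filter]
    push_cast
    refine Finset.sum_congr rfl fun a _ => ?_
    rw [hg, Set.indicator_apply]
    rfl
  have hmp := fun a : Fin N => measurePreserving_eval (fun _ : Fin N => μ) a
  have hL : ∀ a : Fin N, MemLp (fun y : Fin N → ℝ => g (y a)) 2 (Measure.pi fun _ => μ) :=
    fun a => hgL.comp_measurePreserving (hmp a)
  have hXL : MemLp X 2 (Measure.pi fun _ : Fin N => μ) := memLp_finsetSum' _ fun a _ => hL a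
  have hmean : ∫ y, X y ∂(Measure.pi fun _ : Fin N => μ) = N * μ.real {x | p x} := by
    simp_rw [hX, Finset.sum_apply]
    rw [integral_finsetSum _ fun a _ => (hL a).integrable (by norm_num)]
    have : ∀ a : Fin N, ∫ y : Fin N → ℝ, g (y a) ∂(Measure.pi fun _ => μ) = μ.real {x | p x} := by
      intro a
      have := integral_map (hmp a).aemeasurable hgm.aestronglyMeasurable
      rw [(hmp a).map_eq, hgi] at this
      exact this.symm
    simp [this]
  -- An indicator equals its square, so its variance is at most its mean.
  have hvar : variance X (Measure.pi fun _ : Fin N => μ) ≤ N * μ.real {x | p x} := by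
    rw [hX, variance_sum_pi fun _ => hgL]
    calc ∑ _a : Fin N, variance g μ ≤ ∑ _a : Fin N, μ.real {x | p x} := by
          refine Finset.sum_le_sum fun _ _ => ?_
          refine (variance_le_expectation_sq hgm.aestronglyMeasurable).trans_eq ?_
          rw [← hgi]
          refine integral_congr_ae (ae_of_all _ fun x => ?_)
          simp only [hg, Pi.pow_apply, Set.indicator_apply]
          split_ifs <;> simp
      _ = _ := by simp
  have h := meas_ge_le_variance_div_sq hXL hη
  rw [hmean] at h
  simp_rw [hcard] at h
  exact h.trans (ENNReal.ofReal_le_ofReal (by gcongr))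

/-- Chebyshev's inequality for increments of the empirical distribution function. -/
lemma measure_le_abs_card_sub_card_le (N : ℕ) (x c : ℝ) {η : ℝ} (hη : 0 < η) :
    Measure.pi (fun _ : Fin N => μ)
      {y | η ≤ |((Finset.univ.filter fun a => y a ≤ c).card : ℝ) -
        (Finset.univ.filter fun a => y a ≤ x).card - N * (cdf μ c - cdf μ x)|} ≤
      ENNReal.ofReal (N * |cdf μ c - cdf μ x| / η ^ 2) := by
  have key : ∀ u v : ℝ, u ≤ v → (μ.real {w | u < w ∧ w ≤ v} = cdf μ v - cdf μ u) ∧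
      ∀ y : Fin N → ℝ, ((Finset.univ.filter fun a => u < y a ∧ y a ≤ v).card : ℝ) =
        (Finset.univ.filter fun a => y a ≤ v).card - (Finset.univ.filter fun a => y a ≤ u).card := by
    intro u v huv
    constructor
    · rw [cdf_eq_real, cdf_eq_real, ← measureReal_sdiff (Set.Iic_subset_Iic.2 huv) measurableSet_Iic]
      congr 1
      ext w
      simp [and_comm]
    · intro y
      rw [eq_sub_iff_add_eq]
      norm_cast
      rw [← Finset.card_union_of_disjoint]
      · congr 1
        ext a
        simp only [Finset.mem_union, Finset.mem_filter, Finset.mem_univ, true_and]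
        constructor
        · rintro (h | h)
          · exact h.2
          · exact h.trans huv
        · intro h
          rcases lt_or_ge u (y a) with h' | h'
          · exact Or.inl ⟨h', h⟩
          · exact Or.inr h'
      · rw [Finset.disjoint_filter]
        intro a _ h1 h2
        linarith [h1.1]
  rcases le_total x c with h | h
  · obtain ⟨h1, h2⟩ := key x c h
    have h3 := measure_le_abs_card_sub_le (μ := μ) N (fun w => x < w ∧ w ≤ c)
      measurableSet_Ioc hη
    simp_rw [h2, h1] at h3
    rwa [abs_of_nonneg (by rw [← h1]; exact measureReal_nonneg)]
  · obtain ⟨h1, h2⟩ := key c x h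
    have h3 := measure_le_abs_card_sub_le (μ := μ) N (fun w => c < w ∧ w ≤ x)
      measurableSet_Ioc hη
    simp_rw [h2, h1] at h3
    rw [abs_sub_comm, abs_of_nonneg (a := cdf μ x - cdf μ c)
      (by rw [← h1]; exact measureReal_nonneg)]
    have e : ∀ u v s t : ℝ, |u - v - N * (s - t)| = |v - u - N * (t - s)| := by
      intro u v s t
      rw [← abs_neg]
      congr 1
      ring
    refine (measure_mono fun y hy => ?_).trans h3
    rw [Set.mem_ofPred_eq, e] at hy
    exact hy

end Counting

/-! ### From tails to moments, from probability to mean square -/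

section Moments

open scoped ENNReal

variable {Ω : Type*} [MeasurableSpace Ω] {ν : Measure Ω}

/-- Split the layer-cake integral at `a`: below, the probability is at most one; above, `t² (a /
t)⁴` is integrable. Each part contributes `a³`, with prefactor `3`. -/
lemma lintegral_cube_le_of_tail [IsProbabilityMeasure ν] {b : Ω → ℝ} (hb : Measurable b) {a : ℝ}
    (ha : 0 < a) (h : ∀ t, 0 < t → ν {ω | t < |b ω|} ≤ ENNReal.ofReal ((a / t) ^ 4)) :
    ∫⁻ ω, ENNReal.ofReal (|b ω| ^ 3) ∂ν ≤ ENNReal.ofReal (6 * a ^ 3) := by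
  have h1 := lintegral_rpow_eq_lintegral_meas_lt_mul ν
    (ae_of_all _ fun ω => abs_nonneg (b ω)) (by fun_prop) (p := (3 : ℕ)) (by norm_num)
  simp_rw [Real.rpow_natCast, show (((3 : ℕ) : ℝ) - 1) = ((2 : ℕ) : ℝ) by norm_num,
    Real.rpow_natCast] at h1
  rw [h1, ← Set.Ioc_union_Ioi_eq_Ioi ha.le,
    lintegral_union measurableSet_Ioi (Set.Ioc_disjoint_Ioi le_rfl)]
  have h2 : ∫⁻ t in Set.Ioc 0 a, ν {ω | t < |b ω|} * ENNReal.ofReal (t ^ 2) ≤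
      ENNReal.ofReal (a ^ 3) := by
    calc ∫⁻ t in Set.Ioc 0 a, ν {ω | t < |b ω|} * ENNReal.ofReal (t ^ 2)
        ≤ ∫⁻ _t in Set.Ioc 0 a, ENNReal.ofReal (a ^ 2) := by
          refine setLIntegral_mono' measurableSet_Ioc fun t ht => ?_
          calc ν {ω | t < |b ω|} * ENNReal.ofReal (t ^ 2) ≤ 1 * ENNReal.ofReal (a ^ 2) := by
                gcongr
                · exact prob_le_one
                · exact ht.1.le
                · exact ht.2
            _ = _ := one_mul _
      _ = _ := by
        rw [setLIntegral_const, Real.volume_Ioc, sub_zero, ← ENNReal.ofReal_mul (by positivity)]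
        congr 1
  have h3 : ∫⁻ t in Set.Ioi a, ν {ω | t < |b ω|} * ENNReal.ofReal (t ^ 2) ≤
      ENNReal.ofReal (a ^ 3) := by
    calc ∫⁻ t in Set.Ioi a, ν {ω | t < |b ω|} * ENNReal.ofReal (t ^ 2)
        ≤ ∫⁻ t in Set.Ioi a, ENNReal.ofReal (a ^ 4 * t ^ (-2 : ℝ)) := by
          refine setLIntegral_mono' measurableSet_Ioi fun t ht => ?_
          have ht0 : 0 < t := ha.trans ht
          refine (mul_le_mul_left (h t ht0) _).trans_eq ?_
          rw [← ENNReal.ofReal_mul (by positivity)]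
          congr 1
          rw [Real.rpow_neg ht0.le, show (2 : ℝ) = ((2 : ℕ) : ℝ) by norm_num, Real.rpow_natCast]
          field_simp
      _ = ENNReal.ofReal (∫ t in Set.Ioi a, a ^ 4 * t ^ (-2 : ℝ)) := by
          rw [ofReal_integral_eq_lintegral_ofReal]
          · exact (integrableOn_Ioi_rpow_of_lt (by norm_num) ha).const_mul _
          · filter_upwards [ae_restrict_mem measurableSet_Ioi] with t ht
            have ht0 : 0 < t := ha.trans ht
            change 0 ≤ a ^ 4 * t ^ (-2 : ℝ)
            positivity
      _ = _ := by
          rw [integral_const_mul, integral_Ioi_rpow_of_lt (by norm_num) ha]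
          congr 1
          rw [show (-2 + 1 : ℝ) = -((1 : ℕ) : ℝ) by norm_num, Real.rpow_neg ha.le,
            Real.rpow_natCast]
          field_simp
          norm_num
  calc _ ≤ ENNReal.ofReal ((3 : ℕ) : ℝ) * (ENNReal.ofReal (a ^ 3) + ENNReal.ofReal (a ^ 3)) := by
        gcongr
    _ = _ := by
        rw [← ENNReal.ofReal_add (by positivity) (by positivity),
          ← ENNReal.ofReal_mul (by positivity)]
        congr 1; push_cast; ring

lemma lintegral_sq_sub_le_of_cube [IsProbabilityMeasure ν] {b : Ω → ℝ} {a d : ℝ}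
    (ha : 0 < a) (h : ∫⁻ ω, ENNReal.ofReal (|b ω| ^ 3) ∂ν ≤ ENNReal.ofReal (6 * a ^ 3)) :
    ∫⁻ ω, ENNReal.ofReal ((b ω - d) ^ 2) ∂ν ≤ ENNReal.ofReal (14 * a ^ 2 + 2 * d ^ 2) := by
  have hpt : ∀ ω, (b ω - d) ^ 2 ≤ (2 * a ^ 2 + 2 * d ^ 2) + 2 / a * |b ω| ^ 3 := by
    intro ω
    have h1 : (b ω - d) ^ 2 ≤ 2 * |b ω| ^ 2 + 2 * d ^ 2 := by
      rw [sq_abs]; nlinarith [sq_nonneg (b ω + d)]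
    have h2 : |b ω| ^ 2 ≤ a ^ 2 + 1 / a * |b ω| ^ 3 := by
      rcases le_total |b ω| a with h | h
      · have := pow_le_pow_left₀ (abs_nonneg _) h 2
        have : 0 ≤ 1 / a * |b ω| ^ 3 := by positivity
        linarith
      · have : |b ω| ^ 2 ≤ 1 / a * |b ω| ^ 3 := by
          rw [one_div, inv_mul_eq_div, le_div_iff₀ ha]
          nlinarith [mul_le_mul_of_nonneg_left h (sq_nonneg |b ω|)]
        nlinarith [sq_nonneg a]
    have h3 : 2 / a * |b ω| ^ 3 = 2 * (1 / a * |b ω| ^ 3) := by ring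
    linarith
  calc ∫⁻ ω, ENNReal.ofReal ((b ω - d) ^ 2) ∂ν
      ≤ ∫⁻ ω, (ENNReal.ofReal (2 * a ^ 2 + 2 * d ^ 2) +
          ENNReal.ofReal (2 / a) * ENNReal.ofReal (|b ω| ^ 3)) ∂ν := by
        refine lintegral_mono fun ω => ?_
        rw [← ENNReal.ofReal_mul (by positivity), ← ENNReal.ofReal_add (by positivity)
          (by positivity)]
        exact ENNReal.ofReal_le_ofReal (hpt ω)
    _ = ENNReal.ofReal (2 * a ^ 2 + 2 * d ^ 2) +
          ENNReal.ofReal (2 / a) * ∫⁻ ω, ENNReal.ofReal (|b ω| ^ 3) ∂ν := by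
        rw [lintegral_add_left measurable_const, lintegral_const, measure_univ, mul_one,
          lintegral_const_mul' _ _ ENNReal.ofReal_ne_top]
    _ ≤ ENNReal.ofReal (2 * a ^ 2 + 2 * d ^ 2) +
          ENNReal.ofReal (2 / a) * ENNReal.ofReal (6 * a ^ 3) := by gcongr
    _ = _ := by
        rw [← ENNReal.ofReal_mul (by positivity), ← ENNReal.ofReal_add (by positivity)
          (by positivity)]
        congr 1; field_simp; ring

/-- Uniform integrability made quantitative: deviations below `ε`, between `ε` and `L`, and above
`L`, the last paid for by the third moment divided by `L`. -/
lemma lintegral_sq_sub_le_of_prob [IsProbabilityMeasure ν] {b : Ω → ℝ} (hb : Measurable b)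
    {C d ε L : ℝ} (hC : 0 ≤ C) (hd : 0 ≤ d) (hL : 0 < L)
    (h : ∫⁻ ω, ENNReal.ofReal (|b ω| ^ 3) ∂ν ≤ ENNReal.ofReal C) :
    ∫⁻ ω, ENNReal.ofReal ((b ω - d) ^ 2) ∂ν ≤ ENNReal.ofReal (ε ^ 2) +
      ENNReal.ofReal (L ^ 2) * ν {ω | ε < |b ω - d|} + ENNReal.ofReal (4 * (C + d ^ 3) / L) := by
  have hset : MeasurableSet {ω | ε < |b ω - d|} := measurableSet_lt measurable_const (by fun_prop)
  have hcube : ∀ ω, |b ω - d| ^ 3 ≤ 4 * |b ω| ^ 3 + 4 * d ^ 3 := by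
    intro ω
    have h1 : |b ω - d| ≤ |b ω| + d := by
      refine (abs_sub _ _).trans ?_; rw [abs_of_nonneg hd]
    refine (pow_le_pow_left₀ (abs_nonneg _) h1 3).trans ?_
    have h2 := abs_nonneg (b ω)
    nlinarith [mul_nonneg (add_nonneg h2 hd) (sq_nonneg (|b ω| - d))]
  have hpt : ∀ ω, ENNReal.ofReal ((b ω - d) ^ 2) ≤
      Set.indicator {ω | ε < |b ω - d|} (fun _ => ENNReal.ofReal (L ^ 2)) ω +
      (ENNReal.ofReal (ε ^ 2 + 4 * d ^ 3 / L) +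
        ENNReal.ofReal (4 / L) * ENNReal.ofReal (|b ω| ^ 3)) := by
    intro ω
    have hc := hcube ω
    have hcl : |b ω - d| ^ 3 / L ≤ 4 * d ^ 3 / L + 4 / L * |b ω| ^ 3 := by
      rw [div_mul_eq_mul_div, ← add_div]; gcongr; linarith
    rw [← ENNReal.ofReal_mul (by positivity), ← ENNReal.ofReal_add (by positivity)
          (by positivity)]
    by_cases hω : ε < |b ω - d|
    · rw [Set.indicator_of_mem (show ω ∈ {ω | ε < |b ω - d|} from hω),
        ← ENNReal.ofReal_add (by positivity) (by positivity)]
      refine ENNReal.ofReal_le_ofReal ?_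
      rw [← sq_abs]
      rcases le_total |b ω - d| L with hl | hl
      · have := pow_le_pow_left₀ (abs_nonneg _) hl 2
        have h4 : 0 ≤ |b ω - d| ^ 3 / L := by positivity
        nlinarith [sq_nonneg ε]
      · have : |b ω - d| ^ 2 ≤ |b ω - d| ^ 3 / L := by
          rw [le_div_iff₀ hL]
          nlinarith [mul_le_mul_of_nonneg_left hl (sq_nonneg |b ω - d|)]
        nlinarith [sq_nonneg ε, sq_nonneg L]
    · rw [Set.indicator_of_notMem (show ω ∉ {ω | ε < |b ω - d|} from hω), zero_add]
      refine ENNReal.ofReal_le_ofReal ?_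
      rw [← sq_abs]
      have := pow_le_pow_left₀ (abs_nonneg _) (not_lt.1 hω) 2
      have h4 : 0 ≤ |b ω - d| ^ 3 / L := by positivity
      linarith
  calc ∫⁻ ω, ENNReal.ofReal ((b ω - d) ^ 2) ∂ν ≤ _ := lintegral_mono hpt
    _ = ENNReal.ofReal (L ^ 2) * ν {ω | ε < |b ω - d|} + (ENNReal.ofReal (ε ^ 2 + 4 * d ^ 3 / L) +
          ENNReal.ofReal (4 / L) * ∫⁻ ω, ENNReal.ofReal (|b ω| ^ 3) ∂ν) := by
        rw [lintegral_add_left (measurable_const.indicator hset), lintegral_indicator_const hset,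
          lintegral_add_left measurable_const, lintegral_const, measure_univ, mul_one,
          lintegral_const_mul' _ _ ENNReal.ofReal_ne_top]
    _ ≤ ENNReal.ofReal (L ^ 2) * ν {ω | ε < |b ω - d|} + (ENNReal.ofReal (ε ^ 2 + 4 * d ^ 3 / L) +
          ENNReal.ofReal (4 / L) * ENNReal.ofReal C) := by gcongr
    _ = ENNReal.ofReal (L ^ 2) * ν {ω | ε < |b ω - d|} + (ENNReal.ofReal (ε ^ 2) +
          ENNReal.ofReal (4 * (C + d ^ 3) / L)) := by
        rw [← ENNReal.ofReal_mul (by positivity), ← ENNReal.ofReal_add (by positivity)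
          (by positivity), ← ENNReal.ofReal_add (by positivity) (by positivity)]
        congr 2
        ring
    _ = _ := by ring

end Moments

/-! ### Risk of the slope at a fixed point -/

section FixedPoint

open scoped ENNReal

variable {μ : Measure ℝ}

/-- If the slope at `x` is large, many sample points are close to `x`. -/
lemma le_card_of_lt_abs_slopeAt {N m : ℕ} (hm : 2 ≤ m) (hmN : m ≤ N) (l : Fin (N + 1)) {x : ℝ}
    {y : Fin N → ℝ} {r : ℝ} (hr : 0 < r) (h : 5 * m / ((N + 1) * r) < |slopeAt m l x y|) :
    m / 2 ≤ (Finset.univ.filter fun j => |y j - x| ≤ r).card := by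
  by_contra! hlt
  have hcard := card_filter_insertNth l x y (fun w => |w - x| ≤ r)
  have hzl : l.insertNth (α := fun _ => ℝ) x y l = x := Fin.insertNth_apply_same ..
  -- The point `x` itself lies within `r`, so strictly fewer than `m / 2` other points means at most
  -- `m / 2` in all.
  have hgap := lt_orderStat_sub_orderStat (l.insertNth (α := fun _ => ℝ) x y) l (m / 2) (by omega)
    (r := r) (by rw [hzl, hcard]; split_ifs <;> omega)
  have hb := abs_localSlope_le N.succ_pos (l.insertNth (α := fun _ => ℝ) x y)
    (show 0 < m by omega) _ hr hgap.le
  rw [Nat.cast_succ] at hb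
  exact absurd h (not_lt.2 hb)

/-- The local slope at `x` has polynomial tails at the scale of the maximal function at `x`. -/
lemma measure_lt_abs_slopeAt_le [IsProbabilityMeasure μ] {N m : ℕ} (hm : 8 ≤ m) (hmN : m ≤ N) (l : Fin (N + 1)) {x : ℝ}
    (hx : maximalFunction μ x < ∞) {a : ℝ} (ha : 90 * (maximalFunction μ x).toReal ≤ a)
    {t : ℝ} (ht : 0 < t) :
    Measure.pi (fun _ : Fin N => μ) {y | t < |slopeAt m l x y|} ≤
      ENNReal.ofReal ((a / t) ^ 4) := by
  set M := (maximalFunction μ x).toReal with hM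
  have hM0 : 0 ≤ M := ENNReal.toReal_nonneg
  have hN0 : (0 : ℝ) < (N : ℝ) + 1 := by positivity
  have hm0 : (0 : ℝ) < m := by exact_mod_cast (by omega : 0 < m)
  set k := m / 2 with hk
  have hk0 : (0 : ℝ) < k := by exact_mod_cast (by omega : 0 < k)
  have hmk : (m : ℝ) ≤ 3 * k := by exact_mod_cast (by omega : m ≤ 3 * k)
  rcases le_or_gt 1 (a / t) with h1 | h1
  · refine prob_le_one.trans ?_
    rw [ENNReal.one_le_ofReal]
    exact one_le_pow₀ h1
  -- The radius at which the deterministic slope bound equals `t`.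
  set r : ℝ := 5 * m / ((N + 1) * t) with hr
  have hr0 : 0 < r := by positivity
  have hp : μ.real {w | |w - x| ≤ r} ≤ 2 * r * M := by
    have h2 := measure_closedBall_le_maximalFunction μ x hr0
    have h3 : {w | |w - x| ≤ r} = Metric.closedBall x r := by
      ext w; simp [Metric.mem_closedBall, Real.dist_eq]
    rw [h3, measureReal_def, hM, ← ENNReal.toReal_ofReal (show 0 ≤ 2 * r by positivity),
      ← ENNReal.toReal_mul]
    exact ENNReal.toReal_mono (ENNReal.mul_ne_top ENNReal.ofReal_ne_top hx.ne) h2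
  have hsub : {y : Fin N → ℝ | t < |slopeAt m l x y|} ⊆
      {y | k ≤ (Finset.univ.filter fun j => |y j - x| ≤ r).card} := by
    intro y hy
    rw [Set.mem_ofPred_eq] at hy ⊢
    refine le_card_of_lt_abs_slopeAt (by omega) hmN l hr0 (lt_of_eq_of_lt ?_ hy)
    rw [hr]
    field_simp
  have hcount := measure_le_card_le (μ := μ) N (k := k) (by omega) (fun w => |w - x| ≤ r)
  refine (measure_mono hsub).trans (hcount.trans ?_)
  refine ENNReal.ofReal_le_ofReal ?_
  have hE : Real.exp 1 ≤ 3 := Real.exp_one_lt_three.le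
  -- `90 = 3 · 2 · 5 · 3`: from `e ≤ 3`, the factor `2` in the maximal inequality, the slope bound,
  -- and `m ≤ 3 k`.
  have hbase : Real.exp 1 * (N * μ.real {w | |w - x| ≤ r} / k) ≤ a / t := by
    calc Real.exp 1 * (N * μ.real {w | |w - x| ≤ r} / k)
        ≤ 3 * ((N + 1) * (2 * r * M) / k) := by
          gcongr
          linarith
      _ = 30 * M / t * (m / k) := by rw [hr]; field_simp; ring
      _ ≤ 30 * M / t * 3 := by
          gcongr
          rw [div_le_iff₀ hk0]; exact hmk
      _ = 90 * M / t := by ring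
      _ ≤ a / t := by gcongr
  have hbase0 : 0 ≤ Real.exp 1 * (N * μ.real {w | |w - x| ≤ r} / k) := by positivity
  -- Here `a / t < 1`, and `m ≥ 8` gives `k ≥ 4`; a fourth-power tail is enough for third moments.
  calc _ ≤ (a / t) ^ k := pow_le_pow_left₀ hbase0 hbase k
    _ ≤ (a / t) ^ 4 := pow_le_pow_of_le_one (hbase0.trans hbase) h1.le (by omega)

lemma lintegral_slopeAt_cube_le [IsProbabilityMeasure μ] {N m : ℕ} (hm : 8 ≤ m) (hmN : m ≤ N) (l : Fin (N + 1)) {x : ℝ}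
    (hx : maximalFunction μ x < ∞) {a : ℝ} (ha0 : 0 < a)
    (ha : 90 * (maximalFunction μ x).toReal ≤ a) :
    ∫⁻ y, ENNReal.ofReal (|slopeAt m l x y| ^ 3) ∂Measure.pi (fun _ : Fin N => μ) ≤
      ENNReal.ofReal (6 * a ^ 3) :=
  lintegral_cube_le_of_tail (measurable_slopeAt_right m l x) ha0 fun _ ht =>
    measure_lt_abs_slopeAt_le hm hmN l hx ha ht

variable {x d : ℝ} {m : ℕ → ℕ}

/-- The distance `m / ((N + 1) d)` is the scale at which about `m` sample points are expected on one
side of `x`; `m / N → 0` makes it shrink, so the derivative applies. -/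
lemma tendsto_cdf_increment (hd : 0 < d) (hF : HasDerivAt (cdf μ) d x)
    (hm : Tendsto m atTop atTop)
    (hmN : Tendsto (fun N : ℕ => (m N : ℝ) / ((N : ℝ) + 1)) atTop (nhds 0)) (t : ℝ) :
    Tendsto (fun N : ℕ => N * (cdf μ (x + t * (m N / ((N + 1) * d))) - cdf μ x) / m N) atTop
      (nhds t) := by
  rcases eq_or_ne t 0 with rfl | ht
  · simp
  have hm0 : ∀ᶠ N in atTop, 0 < m N := hm.eventually_gt_atTop 0
  have hh : Tendsto (fun N : ℕ => t * ((m N : ℝ) / ((N + 1) * d))) atTop (nhdsWithin 0 {0}ᶜ) := by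
    refine tendsto_nhdsWithin_iff.2 ⟨?_, ?_⟩
    · have := (hmN.const_mul (t / d))
      rw [mul_zero] at this
      refine this.congr fun N => ?_
      field_simp
    · filter_upwards [hm0] with N hN
      have : (0 : ℝ) < m N := by exact_mod_cast hN
      simp only [Set.mem_compl_iff, Set.mem_singleton_iff]
      positivity
  have hs := (hasDerivAt_iff_tendsto_slope_zero.1 hF).comp hh
  have h1 : Tendsto (fun N : ℕ => (N : ℝ) / ((N : ℝ) + 1)) atTop (nhds 1) :=
    tendsto_natCast_div_add_atTop 1
  have h2 := (h1.mul_const (t / d)).mul hs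
  have h3 : 1 * (t / d) * d = t := by field_simp
  rw [h3] at h2
  refine h2.congr' ?_
  filter_upwards [hm0] with N hN
  have : (0 : ℝ) < m N := by exact_mod_cast hN
  simp only [Function.comp_apply, smul_eq_mul]
  field_simp

/-- The count has variance of order `m`, against a squared threshold of order `m²`; hence `m → ∞`
suffices. -/
lemma tendsto_measure_count [IsProbabilityMeasure μ] (hd : 0 < d) (hF : HasDerivAt (cdf μ) d x)
    (hm : Tendsto m atTop atTop)
    (hmN : Tendsto (fun N : ℕ => (m N : ℝ) / ((N : ℝ) + 1)) atTop (nhds 0)) (t : ℝ) {κ : ℝ}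
    (hκ : 0 < κ) :
    Tendsto (fun N : ℕ => Measure.pi (fun _ : Fin N => μ)
      {y | 2 * κ * m N ≤
        |((Finset.univ.filter fun a => y a ≤ x + t * (m N / ((N + 1) * d))).card : ℝ) -
          (Finset.univ.filter fun a => y a ≤ x).card - t * m N|}) atTop (nhds 0) := by
  have hu := tendsto_cdf_increment hd hF hm hmN t
  have hm' : Tendsto (fun N => (m N : ℝ)) atTop atTop := tendsto_natCast_atTop_atTop.comp hm
  have hlim : Tendsto (fun N : ℕ => ENNReal.ofReal
      (|N * (cdf μ (x + t * (m N / ((N + 1) * d))) - cdf μ x) / m N| / κ ^ 2 / m N))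
      atTop (nhds 0) := by
    have := (hu.abs.div_const (κ ^ 2)).div_atTop hm'
    simpa using ENNReal.tendsto_ofReal this
  refine tendsto_of_tendsto_of_tendsto_of_le_of_le' tendsto_const_nhds hlim
    (Eventually.of_forall fun _ => bot_le) ?_
  filter_upwards [hm.eventually_gt_atTop 0,
    (tendsto_order.1 (tendsto_iff_dist_tendsto_zero.1 hu)).2 κ hκ] with N hN hclose
  have hN' : (0 : ℝ) < m N := by exact_mod_cast hN
  rw [Real.dist_eq] at hclose
  set c := x + t * (m N / ((N + 1) * d))
  have hclose' : |N * (cdf μ c - cdf μ x) - t * m N| ≤ κ * m N := by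
    have : N * (cdf μ c - cdf μ x) - t * m N = (N * (cdf μ c - cdf μ x) / m N - t) * m N := by
      field_simp
    rw [this, abs_mul, abs_of_pos hN']
    gcongr
  refine (measure_mono fun y hy => ?_).trans
    ((measure_le_abs_card_sub_card_le N x c (show 0 < κ * m N by positivity)).trans_eq ?_)
  · rw [Set.mem_ofPred_eq] at hy ⊢
    have := abs_sub_le (((Finset.univ.filter fun a => y a ≤ c).card : ℝ) -
      (Finset.univ.filter fun a => y a ≤ x).card) (N * (cdf μ c - cdf μ x)) (t * m N)
    linarith
  · congr 1
    rw [abs_div, abs_mul, Nat.abs_cast, abs_of_pos hN']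
    field_simp

/-- Deterministic consistency of the slope at `x` when the counts near `x` are regular. -/
lemma abs_slopeAt_sub_le {N k : ℕ} (hd : 0 < d) {K : ℕ} (hK : 120 ≤ K) (hkK : 2 * K ≤ k)
    (l : Fin (N + 1)) {y : Fin N → ℝ} (hyx : ∀ a, y a ≠ x)
    (h : ∀ q ∈ Finset.Icc (-(K + 2) : ℤ) (K + 2),
      |((Finset.univ.filter fun a => y a ≤ x + q / K * (k / ((N + 1) * d))).card : ℝ) -
          (Finset.univ.filter fun a => y a ≤ x).card - q / K * k| < 2 * (1 / (4 * K)) * k) :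
    |slopeAt k l x y - d| ≤ 100 / K * d := by
  have hK0 : (0 : ℝ) < K := by exact_mod_cast (by omega : 0 < K)
  have hk0 : (0 : ℝ) < k := by exact_mod_cast (by omega : 0 < k)
  have hkK' : 2 * (K : ℝ) ≤ k := by exact_mod_cast hkK
  set δ : ℝ := k / ((N + 1) * d) with hδ
  have hδ0 : 0 < δ := by positivity
  set z := l.insertNth (α := fun _ => ℝ) x y with hz
  have hzl : z l = x := Fin.insertNth_apply_same ..
  have hrank : (sampleRank z l : ℝ) = 1 + (Finset.univ.filter fun a => y a ≤ x).card := by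
    rw [sampleRank_eq_card z l, hzl, hz, card_filter_insertNth l x y (· ≤ x)]
    · simp
    · rw [hzl]
      refine l.forall_iff_succAbove.2 ⟨fun _ => rfl, fun a ha => ?_⟩
      rw [hz, Fin.insertNth_apply_succAbove] at ha
      exact absurd ha (hyx a)
  have hgrid := abs_orderStat_sub_le z (m := k) (by omega) (sampleRank z l) (x := x) hδ0
    (K := K) (by omega) (by
      intro q hq
      have h1 := abs_lt.1 (h q hq)
      -- Half of the tolerance `k / K` is for random error; the other half, at least `1` since `2 K
      -- ≤ k`, absorbs the unit by which inserting `x` shifts counts and rank.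
      have h2 : 2 * (1 / (4 * (K : ℝ))) * k = k / K / 2 := by field_simp; norm_num
      have h3 : 2 ≤ (k : ℝ) / K := by rw [le_div_iff₀ hK0]; exact hkK'
      rw [h2] at h1
      rw [hrank, hz, card_filter_insertNth l x y (· ≤ x + q / K * δ)]
      push_cast
      rw [abs_le]
      split_ifs <;> constructor <;> linarith [h1.1, h1.2])
  have hmain := abs_localSlope_sub_le (Nat.succ_pos N) z (m := k) (by omega) (sampleRank z l)
    (x := x) (D := δ / k) (ε := 2 / K) (by positivity) (by positivity)
    (by
      have : (120 : ℝ) ≤ K := by exact_mod_cast hK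
      rw [div_le_div_iff₀ hK0 (by norm_num)]; linarith) hgrid
  have hnD : 1 / (((N + 1 : ℕ) : ℝ) * (δ / k)) = d := by
    rw [hδ]; push_cast; field_simp
  rw [hnD] at hmain
  refine hmain.trans_eq ?_
  ring

/-- The slope at `x` converges in probability to the density at `x`, uniformly in the position of
`x` in the sample. -/
lemma eventually_measure_slopeAt_le [IsProbabilityMeasure μ] [NullSingletonClass μ] (hd : 0 < d) (hF : HasDerivAt (cdf μ) d x)
    (hm : Tendsto m atTop atTop)
    (hmN : Tendsto (fun N : ℕ => (m N : ℝ) / ((N : ℝ) + 1)) atTop (nhds 0)) {ε : ℝ}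
    (hε : 0 < ε) {η : ℝ≥0∞} (hη : 0 < η) :
    ∀ᶠ N in atTop, ∀ l : Fin (N + 1),
      Measure.pi (fun _ : Fin N => μ) {y | ε < |slopeAt (m N) l x y - d|} ≤ η := by
  obtain ⟨K₀, hK₀⟩ := exists_nat_gt (100 * d / ε)
  set K := max K₀ 120 with hKdef
  have hK : 120 ≤ K := le_max_right _ _
  have hK0 : (0 : ℝ) < K := by exact_mod_cast (by omega : 0 < K)
  have hKε : 100 / K * d ≤ ε := by
    have h1 : (K₀ : ℝ) ≤ K := by exact_mod_cast le_max_left _ _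
    have h2 : 100 * d / ε ≤ K := hK₀.le.trans h1
    rw [div_le_iff₀ hε] at h2
    rw [div_mul_eq_mul_div, div_le_iff₀ hK0]
    linarith
  have hκ : (0 : ℝ) < 1 / (4 * K) := by positivity
  have hsum := tendsto_finsetSum (Finset.Icc (-(K + 2) : ℤ) (K + 2)) fun q _ =>
    tendsto_measure_count hd hF hm hmN ((q : ℝ) / K) hκ
  rw [Finset.sum_const_zero] at hsum
  filter_upwards [(tendsto_order.1 hsum).2 η hη, hm.eventually_ge_atTop (2 * K)] with N hN hmK l
  refine le_trans ?_ hN.le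
  -- The law has no atoms, so almost surely nothing ties with `x` and its rank is a count.
  have hne : ∀ᵐ y ∂Measure.pi (fun _ : Fin N => μ), ∀ a, y a ≠ x := by
    rw [ae_all_iff]
    intro a
    have h0 : ∀ᵐ w ∂μ, w ≠ x := by
      rw [ae_iff]; simp
    exact (measurePreserving_eval (fun _ : Fin N => μ) a).quasiMeasurePreserving.ae h0
  refine le_trans ?_ (measure_biUnion_finset_le _ _)
  refine measure_mono_ae ?_
  filter_upwards [hne] with y hy hbad
  by_contra hcon
  have hgood := abs_slopeAt_sub_le hd hK hmK l hy (fun q hq => by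
    by_contra! hq'
    exact hcon (Set.mem_biUnion hq hq'))
  exact absurd (show ε < |slopeAt (m N) l x y - d| from hbad) (not_lt.2 (hgood.trans hKε))

lemma eventually_lintegral_slopeAt_le [IsProbabilityMeasure μ] [NullSingletonClass μ] (hx : maximalFunction μ x < ∞)
    (hd : 0 < d) (hF : HasDerivAt (cdf μ) d x) (hm : Tendsto m atTop atTop)
    (hmN : Tendsto (fun N : ℕ => (m N : ℝ) / ((N : ℝ) + 1)) atTop (nhds 0)) {η : ℝ}
    (hη : 0 < η) :
    ∀ᶠ N in atTop, ∀ l : Fin (N + 1),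
      ∫⁻ y, ENNReal.ofReal ((slopeAt (m N) l x y - d) ^ 2) ∂Measure.pi (fun _ : Fin N => μ) ≤
        ENNReal.ofReal (3 * η) := by
  set a := 90 * (maximalFunction μ x).toReal + 1 with ha
  have ha0 : 0 < a := by positivity
  -- Chosen so that the contribution of deviations above `L` is exactly `η`.
  set L := 4 * (6 * a ^ 3 + d ^ 3) / η with hL
  have hL0 : 0 < L := by positivity
  have hmle : ∀ᶠ N in atTop, m N ≤ N := by
    filter_upwards [(tendsto_order.1 hmN).2 1 one_pos] with N hN
    rw [div_lt_one (by positivity)] at hN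
    have : m N < N + 1 := by exact_mod_cast hN
    omega
  have hη2 : 0 < ENNReal.ofReal (η / L ^ 2) := by rw [ENNReal.ofReal_pos]; positivity
  filter_upwards [hmle, hm.eventually_ge_atTop 8,
    eventually_measure_slopeAt_le hd hF hm hmN (Real.sqrt_pos.2 hη) hη2] with N h1 h2 h3 l
  refine (lintegral_sq_sub_le_of_prob (measurable_slopeAt_right _ l x) (ε := √η) (by positivity)
    hd.le hL0 (lintegral_slopeAt_cube_le h2 h1 l hx ha0 (by linarith))).trans ?_
  calc _ ≤ ENNReal.ofReal (√η ^ 2) + ENNReal.ofReal (L ^ 2) * ENNReal.ofReal (η / L ^ 2) +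
        ENNReal.ofReal (4 * (6 * a ^ 3 + d ^ 3) / L) := by gcongr; exact h3 l
    _ = _ := by
      rw [Real.sq_sqrt hη.le, ← ENNReal.ofReal_mul (by positivity),
        ← ENNReal.ofReal_add (by positivity) (by positivity),
        ← ENNReal.ofReal_add (by positivity) (by positivity)]
      congr 1
      have : 4 * (6 * a ^ 3 + d ^ 3) / L = η := by rw [hL]; field_simp
      rw [this]
      field_simp
      ring

end FixedPoint

/-! ### Integrating the risk over the law -/

section Integrated

open scoped ENNReal

variable {μ : Measure ℝ} {f : ℝ → ℝ} {m : ℕ → ℕ}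

lemma ae_hasDerivAt_cdf [IsProbabilityMeasure μ] (hf : Measurable f) (hf0 : ∀ x, 0 ≤ f x)
    (hμ : μ = volume.withDensity fun x => ENNReal.ofReal (f x)) :
    ∀ᵐ x, HasDerivAt (cdf μ) (f x) x := by
  have h1 := (cdf μ).ae_hasDerivAt
  rw [measure_cdf] at h1
  have h2 : μ.rnDeriv volume =ᵐ[volume] fun x => ENNReal.ofReal (f x) := by
    conv_lhs => rw [hμ]
    exact Measure.rnDeriv_withDensity _ hf.ennreal_ofReal
  filter_upwards [h1, h2] with x hx1 hx2
  rwa [hx2, ENNReal.toReal_ofReal (hf0 x)] at hx1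

/-- Pointwise consistency needs positive density; the zeros of `f` carry no mass. -/
lemma ae_pos_of_withDensity (hf : Measurable f)
    (hμ : μ = volume.withDensity fun x => ENNReal.ofReal (f x)) : ∀ᵐ x ∂μ, 0 < f x := by
  rw [hμ, ae_withDensity_iff hf.ennreal_ofReal]
  refine ae_of_all _ fun x hx => ?_
  by_contra! h
  exact hx (ENNReal.ofReal_eq_zero.2 h)

/-- The mean square distance of the slopes to the density at the sample points tends to zero. -/
lemma tendsto_lintegral_slopeAt [IsProbabilityMeasure μ] (hf : Measurable f) (hf0 : ∀ x, 0 ≤ f x)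
    (hμ : μ = volume.withDensity fun x => ENNReal.ofReal (f x))
    (hf3 : Integrable (fun x => f x ^ 3)) (hm : Tendsto m atTop atTop)
    (hmN : Tendsto (fun N : ℕ => (m N : ℝ) / ((N : ℝ) + 1)) atTop (nhds 0)) :
    Tendsto (fun N : ℕ => ∫⁻ x, ((N : ℝ≥0∞) + 1)⁻¹ * ∑ l : Fin (N + 1),
      ∫⁻ y, ENNReal.ofReal ((slopeAt (m N) l x y - f x) ^ 2) ∂Measure.pi (fun _ : Fin N => μ) ∂μ)
      atTop (nhds 0) := by
  have hac : μ ≪ volume := by rw [hμ]; exact withDensity_absolutelyContinuous _ _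
  have : NullSingletonClass μ := ⟨fun x => hac (by simp)⟩
  have hMtop : ∀ᵐ x ∂μ, maximalFunction μ x < ∞ := hac.ae_le (ae_maximalFunction_lt_top hf hμ)
  have hder : ∀ᵐ x ∂μ, HasDerivAt (cdf μ) (f x) x := hac.ae_le (ae_hasDerivAt_cdf hf hf0 hμ)
  have hpos := ae_pos_of_withDensity hf hμ
  obtain ⟨hM2, hf2⟩ := lintegral_maximalFunction_sq_lt_top hf hf0 hμ hf3
  have hMm := (measurable_maximalFunction μ).ennreal_toReal
  have havg : ∀ (N : ℕ) (g : Fin (N + 1) → ℝ≥0∞) (C : ℝ≥0∞), (∀ l, g l ≤ C) →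
      ((N : ℝ≥0∞) + 1)⁻¹ * ∑ l, g l ≤ C := by
    intro N g C hg
    calc ((N : ℝ≥0∞) + 1)⁻¹ * ∑ l, g l ≤ ((N : ℝ≥0∞) + 1)⁻¹ * ∑ _l : Fin (N + 1), C := by
          gcongr with l; exact hg l
      _ = C := by
          rw [Finset.sum_const, Finset.card_univ, Fintype.card_fin, nsmul_eq_mul, ← mul_assoc]
          push_cast
          rw [ENNReal.inv_mul_cancel (by positivity) (by finiteness), one_mul]
  have hmle : ∀ᶠ N in atTop, m N ≤ N := by
    filter_upwards [(tendsto_order.1 hmN).2 1 one_pos] with N hN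
    rw [div_lt_one (by positivity)] at hN
    have : m N < N + 1 := by exact_mod_cast hN
    omega
  rw [show (0 : ℝ≥0∞) = ∫⁻ _x, 0 ∂μ by simp]
  -- The dominating function comes from the third moment bound with `a = 90 M + 1`, where `M` is the
  -- maximal function and the `1` keeps `a` positive.
  refine tendsto_lintegral_filter_of_dominated_convergence
    (fun x => ENNReal.ofReal (14 * (90 * (maximalFunction μ x).toReal + 1) ^ 2 + 2 * f x ^ 2))
    (Eventually.of_forall fun N => ?_) ?_ ?_ ?_
  · refine Measurable.const_mul (Finset.measurable_sum _ fun l _ => ?_) _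
    refine Measurable.lintegral_prod_right' (f := fun p : ℝ × (Fin N → ℝ) =>
      ENNReal.ofReal ((slopeAt (m N) l p.1 p.2 - f p.1) ^ 2)) ?_
    have := measurable_slopeAt (m N) l
    fun_prop
  · filter_upwards [hmle, hm.eventually_ge_atTop 8] with N h1 h2
    filter_upwards [hMtop] with x hx
    refine havg N _ _ fun l => ?_
    exact lintegral_sq_sub_le_of_cube (by positivity)
      (lintegral_slopeAt_cube_le h2 h1 l hx (by positivity) (by linarith))
  · refine ne_of_lt ?_
    calc ∫⁻ x, ENNReal.ofReal (14 * (90 * (maximalFunction μ x).toReal + 1) ^ 2 + 2 * f x ^ 2) ∂μ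
        ≤ ∫⁻ x, (ENNReal.ofReal 226800 * ENNReal.ofReal ((maximalFunction μ x).toReal ^ 2) +
            (ENNReal.ofReal 28 + ENNReal.ofReal 2 * ENNReal.ofReal (f x ^ 2))) ∂μ := by
          refine lintegral_mono fun x => ?_
          rw [← ENNReal.ofReal_mul (by norm_num), ← ENNReal.ofReal_mul (by norm_num),
            ← ENNReal.ofReal_add (by positivity) (by positivity),
            ← ENNReal.ofReal_add (by positivity) (by positivity)]
          refine ENNReal.ofReal_le_ofReal ?_
          nlinarith [sq_nonneg (90 * (maximalFunction μ x).toReal - 1)]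
      _ < ∞ := by
          rw [lintegral_add_left (by fun_prop), lintegral_add_left measurable_const,
            lintegral_const, measure_univ, lintegral_const_mul' _ _ ENNReal.ofReal_ne_top,
            lintegral_const_mul' _ _ ENNReal.ofReal_ne_top]
          exact ENNReal.add_lt_top.2 ⟨ENNReal.mul_lt_top ENNReal.ofReal_lt_top hM2,
            ENNReal.add_lt_top.2 ⟨by finiteness, ENNReal.mul_lt_top ENNReal.ofReal_lt_top hf2⟩⟩
  · filter_upwards [hMtop, hder, hpos] with x h1 h2 h3
    rw [ENNReal.tendsto_nhds_zero]
    intro η hη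
    obtain ⟨ρ, hρ0, hρ⟩ : ∃ ρ : ℝ, 0 < ρ ∧ ENNReal.ofReal (3 * ρ) ≤ η := by
      rcases eq_or_ne η ∞ with rfl | hne
      · exact ⟨1, one_pos, le_top⟩
      · refine ⟨η.toReal / 3, div_pos (ENNReal.toReal_pos hη.ne' hne) (by norm_num), ?_⟩
        rw [mul_div_cancel₀ _ (by norm_num : (3 : ℝ) ≠ 0), ENNReal.ofReal_toReal hne]
    filter_upwards [eventually_lintegral_slopeAt_le h1 h3 h2 hm hmN hρ0] with N hN
    exact havg N _ _ fun l => (hN l).trans hρ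

end Integrated

/-! ### Comparing empirical moments -/

section Averages

lemma abs_average_sub_le {n : ℕ} (hn : 0 < n) (u v : Fin n → ℝ) :
    |1 / (n : ℝ) * ∑ l, u l - 1 / (n : ℝ) * ∑ l, v l| ≤
      √(1 / (n : ℝ) * ∑ l, (u l - v l) ^ 2) := by
  have hn' : (0 : ℝ) < n := by exact_mod_cast hn
  refine Real.abs_le_sqrt ?_
  have h := sq_sum_le_card_mul_sum_sq (s := Finset.univ) (f := fun l => u l - v l)
  rw [Finset.card_univ, Fintype.card_fin, Finset.sum_sub_distrib] at h
  rw [← mul_sub, mul_pow]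
  calc (1 / (n : ℝ)) ^ 2 * (∑ l, u l - ∑ l, v l) ^ 2
      ≤ (1 / (n : ℝ)) ^ 2 * (n * ∑ l, (u l - v l) ^ 2) := by gcongr
    _ = _ := by field_simp

/-- Write `u² - v² = (u - v)² + 2 (u - v) v` and apply Cauchy–Schwarz to the cross term; only the
moments of `v` need control. -/
lemma abs_average_sq_sub_le {n : ℕ} (hn : 0 < n) (u v : Fin n → ℝ) :
    |1 / (n : ℝ) * ∑ l, u l ^ 2 - 1 / (n : ℝ) * ∑ l, v l ^ 2| ≤
      1 / (n : ℝ) * ∑ l, (u l - v l) ^ 2 +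
        2 * √((1 / (n : ℝ) * ∑ l, (u l - v l) ^ 2) * (1 / (n : ℝ) * ∑ l, v l ^ 2)) := by
  have hn' : (0 : ℝ) < n := by exact_mod_cast hn
  have hexp : 1 / (n : ℝ) * ∑ l, u l ^ 2 - 1 / (n : ℝ) * ∑ l, v l ^ 2 =
      1 / (n : ℝ) * ∑ l, (u l - v l) ^ 2 + 2 * (1 / (n : ℝ) * ∑ l, (u l - v l) * v l) := by
    simp only [Finset.mul_sum]
    rw [← Finset.sum_sub_distrib, ← Finset.sum_add_distrib]
    exact Finset.sum_congr rfl fun l _ => by ring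
  have hcs : |1 / (n : ℝ) * ∑ l, (u l - v l) * v l| ≤
      √((1 / (n : ℝ) * ∑ l, (u l - v l) ^ 2) * (1 / (n : ℝ) * ∑ l, v l ^ 2)) := by
    refine Real.abs_le_sqrt ?_
    have h := Finset.sum_mul_sq_le_sq_mul_sq Finset.univ (fun l => u l - v l) v
    rw [mul_pow]
    calc (1 / (n : ℝ)) ^ 2 * (∑ l, (u l - v l) * v l) ^ 2
        ≤ (1 / (n : ℝ)) ^ 2 * ((∑ l, (u l - v l) ^ 2) * ∑ l, v l ^ 2) := by gcongr
      _ = _ := by ring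
  have hnn : 0 ≤ 1 / (n : ℝ) * ∑ l, (u l - v l) ^ 2 :=
    mul_nonneg (by positivity) (Finset.sum_nonneg fun _ _ => sq_nonneg _)
  rw [hexp]
  refine (abs_add_le _ _).trans ?_
  rw [abs_of_nonneg hnn, abs_mul, abs_two]
  linarith

end Averages

/-! ### The estimator as a function of the sample -/

section Estimator

open scoped ENNReal

/-- The mean square distance between the local slopes and the values of `f` at the sample
points. -/
def slopeError (f : ℝ → ℝ) (m : ℕ) {n : ℕ} (z : Fin n → ℝ) : ℝ :=
  1 / (n : ℝ) * ∑ l, (localSlope m z (sampleRank z l) - f (z l)) ^ 2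

lemma slopeError_nonneg (f : ℝ → ℝ) (m : ℕ) {n : ℕ} (z : Fin n → ℝ) : 0 ≤ slopeError f m z :=
  mul_nonneg (by positivity) (Finset.sum_nonneg fun _ _ => sq_nonneg _)

lemma measurable_slopeError {f : ℝ → ℝ} (hf : Measurable f) (m n : ℕ) :
    Measurable fun z : Fin n → ℝ => slopeError f m z := by
  unfold slopeError
  refine Measurable.const_mul (Finset.measurable_sum _ fun l _ => ?_) _
  have := measurable_localSlope_sampleRank m l
  fun_prop

lemma correaVarextropy_eq (m : ℕ) {n : ℕ} (z : Fin n → ℝ) :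
    correaVarextropy m z = 1 / 4 * (1 / (n : ℝ) * ∑ l, localSlope m z (sampleRank z l) ^ 2 -
      (1 / (n : ℝ) * ∑ l, localSlope m z (sampleRank z l)) ^ 2) := by
  unfold correaVarextropy
  rw [sum_Icc_eq_sum_sampleRank z fun i => localSlope m z i ^ 2,
    sum_Icc_eq_sum_sampleRank z fun i => localSlope m z i, mul_comm (4 : ℝ), ← div_div]
  ring

lemma measurable_correaVarextropy (m n : ℕ) :
    Measurable fun z : Fin n → ℝ => correaVarextropy m z := by
  unfold correaVarextropy
  have := fun i => measurable_localSlope (n := n) m i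
  fun_prop

/-- Fubini in the `l`-th coordinate: with that point fixed at `x`, the other `N` remain an
independent sample. -/
lemma lintegral_slopeError {μ : Measure ℝ} [IsProbabilityMeasure μ] {f : ℝ → ℝ}
    (hf : Measurable f) (m N : ℕ) :
    ∫⁻ z, ENNReal.ofReal (slopeError f m z) ∂Measure.pi (fun _ : Fin (N + 1) => μ) =
      ∫⁻ x, ((N : ℝ≥0∞) + 1)⁻¹ * ∑ l : Fin (N + 1),
        ∫⁻ y, ENNReal.ofReal ((slopeAt m l x y - f x) ^ 2) ∂Measure.pi (fun _ : Fin N => μ) ∂μ := by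
  have hmeas : ∀ l : Fin (N + 1), Measurable fun z : Fin (N + 1) → ℝ =>
      ENNReal.ofReal ((localSlope m z (sampleRank z l) - f (z l)) ^ 2) := fun l => by
    have := measurable_localSlope_sampleRank m l
    fun_prop
  have hmeas2 : ∀ l : Fin (N + 1), Measurable fun p : ℝ × (Fin N → ℝ) =>
      ENNReal.ofReal ((slopeAt m l p.1 p.2 - f p.1) ^ 2) := fun l => by
    have := measurable_slopeAt m l
    fun_prop
  have hmeas3 : ∀ l : Fin (N + 1), Measurable fun x : ℝ =>
      ∫⁻ y, ENNReal.ofReal ((slopeAt m l x y - f x) ^ 2) ∂Measure.pi (fun _ : Fin N => μ) :=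
    fun l => (hmeas2 l).lintegral_prod_right'
  have hl : ∀ l : Fin (N + 1),
      ∫⁻ z, ENNReal.ofReal ((localSlope m z (sampleRank z l) - f (z l)) ^ 2)
        ∂Measure.pi (fun _ : Fin (N + 1) => μ) =
      ∫⁻ x, ∫⁻ y, ENNReal.ofReal ((slopeAt m l x y - f x) ^ 2)
        ∂Measure.pi (fun _ : Fin N => μ) ∂μ := by
    intro l
    have hmp := (measurePreserving_piFinSuccAbove (fun _ : Fin (N + 1) => μ) l).symm
    rw [← hmp.lintegral_comp (hmeas l), lintegral_prod _ (by
      exact ((hmeas l).comp hmp.measurable).aemeasurable)]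
    refine lintegral_congr fun x => lintegral_congr fun y => ?_
    have hz : (MeasurableEquiv.piFinSuccAbove (fun _ => ℝ) l).symm (x, y) =
      l.insertNth (α := fun _ => ℝ) x y := rfl
    rw [hz, Fin.insertNth_apply_same]
    rfl
  have hpt : ∀ z : Fin (N + 1) → ℝ, ENNReal.ofReal (slopeError f m z) =
      ((N : ℝ≥0∞) + 1)⁻¹ * ∑ l,
        ENNReal.ofReal ((localSlope m z (sampleRank z l) - f (z l)) ^ 2) := by
    intro z
    unfold slopeError
    rw [ENNReal.ofReal_mul (by positivity), ENNReal.ofReal_sum_of_nonneg fun _ _ => sq_nonneg _,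
      one_div, ENNReal.ofReal_inv_of_pos (by positivity), ENNReal.ofReal_natCast]
    push_cast
    rfl
  simp_rw [hpt]
  rw [lintegral_const_mul _ (Finset.measurable_sum _ fun l _ => hmeas l),
    lintegral_finsetSum _ fun l _ => hmeas l,
    lintegral_const_mul _ (Finset.measurable_sum _ fun l _ => hmeas3 l),
    lintegral_finsetSum _ fun l _ => hmeas3 l]
  simp_rw [hl]

lemma tendsto_correaVarextropy {z : (n : ℕ) → Fin n → ℝ} {f : ℝ → ℝ} {m : ℕ → ℕ} {α β : ℝ}
    {ns : ℕ → ℕ} (hns : Tendsto ns atTop atTop)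
    (hα : Tendsto (fun k => 1 / (ns k : ℝ) * ∑ l, f (z (ns k) l)) atTop (nhds α))
    (hβ : Tendsto (fun k => 1 / (ns k : ℝ) * ∑ l, f (z (ns k) l) ^ 2) atTop (nhds β))
    (hD : Tendsto (fun k => slopeError f (m (ns k)) (z (ns k))) atTop (nhds 0)) :
    Tendsto (fun k => correaVarextropy (m (ns k)) (z (ns k))) atTop
      (nhds (1 / 4 * (β - α ^ 2))) := by
  have hn0 : ∀ᶠ k in atTop, 0 < ns k := hns.eventually_gt_atTop 0
  have hsqrt : Tendsto (fun k => √(slopeError f (m (ns k)) (z (ns k)))) atTop (nhds 0) := by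
    simpa using hD.sqrt
  have hA := squeeze_zero_norm' (f := fun k =>
    1 / (ns k : ℝ) * ∑ l, localSlope (m (ns k)) (z (ns k)) (sampleRank (z (ns k)) l) -
      1 / (ns k : ℝ) * ∑ l, f (z (ns k) l)) (by
      filter_upwards [hn0] with k hk
      exact abs_average_sub_le hk _ _) hsqrt
  have hBlim : Tendsto (fun k => slopeError f (m (ns k)) (z (ns k)) +
      2 * √(slopeError f (m (ns k)) (z (ns k)) * (1 / (ns k : ℝ) * ∑ l, f (z (ns k) l) ^ 2)))
      atTop (nhds 0) := by
    simpa using hD.add (((hD.mul hβ).sqrt).const_mul 2)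
  have hB := squeeze_zero_norm' (f := fun k =>
    1 / (ns k : ℝ) * ∑ l, localSlope (m (ns k)) (z (ns k)) (sampleRank (z (ns k)) l) ^ 2 -
      1 / (ns k : ℝ) * ∑ l, f (z (ns k) l) ^ 2) (by
      filter_upwards [hn0] with k hk
      exact abs_average_sq_sub_le hk _ _) hBlim
  simp_rw [correaVarextropy_eq]
  have hA' := hA.add hα
  have hB' := hB.add hβ
  simp only [sub_add_cancel, zero_add] at hA' hB'
  exact (hB'.sub (hA'.pow 2)).const_mul _

end Estimator

/-! ### Transfer to the random sample -/

section Sample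

open scoped ENNReal

variable {Ω : Type*} [MeasurableSpace Ω] {P : Measure Ω}
  {X : ℕ → Ω → ℝ} {f : ℝ → ℝ} {m : ℕ → ℕ}

lemma map_sample_eq_pi [IsProbabilityMeasure P] (hindep : iIndepFun X P) (hident : ∀ i, IdentDistrib (X i) (X 0) P P)
    (n : ℕ) : P.map (fun ω (i : Fin n) => X i ω) = Measure.pi fun _ => P.map (X 0) := by
  have h := (iIndepFun_iff_map_fun_eq_pi_map (f := fun i : Fin n => X i)
    fun i => (hident i).aemeasurable_fst).1 (hindep.precomp Fin.val_injective)
  rw [h]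
  congr 1
  funext i
  exact (hident i).map_eq

lemma aemeasurable_sample (hident : ∀ i, IdentDistrib (X i) (X 0) P P) (n : ℕ) :
    AEMeasurable (fun ω (i : Fin n) => X i ω) P :=
  aemeasurable_pi_lambda _ fun i => (hident i).aemeasurable_fst

lemma tendstoInMeasure_slopeError [IsProbabilityMeasure P] (hindep : iIndepFun X P)
    (hident : ∀ i, IdentDistrib (X i) (X 0) P P) (hpdf : IsPdfOf f (X 0) P)
    (hf3 : Integrable (fun x => f x ^ 3)) (hm : Tendsto m atTop atTop)
    (hmn : Tendsto (fun n : ℕ => (m n : ℝ) / (n : ℝ)) atTop (nhds 0)) :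
    TendstoInMeasure P (fun (n : ℕ) (ω : Ω) => slopeError f (m n) (fun i : Fin n => X i ω))
      atTop 0 := by
  have : IsProbabilityMeasure (P.map (X 0)) := Measure.isProbabilityMeasure_map hpdf.aemeasurable
  have hmeas : ∀ n : ℕ, AEMeasurable (fun ω => slopeError f (m n) (fun i : Fin n => X i ω)) P :=
    fun n => (measurable_slopeError hpdf.measurable (m n) n).comp_aemeasurable
      (aemeasurable_sample hident n)
  refine tendstoInMeasure_of_tendsto_eLpNorm (p := 1) one_ne_zero
    (fun n => (hmeas n).aestronglyMeasurable) aestronglyMeasurable_zero ?_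
  have hmN : Tendsto (fun N : ℕ => (m (N + 1) : ℝ) / ((N : ℝ) + 1)) atTop (nhds 0) := by
    have := (tendsto_add_atTop_iff_nat 1).2 hmn
    simpa using this
  have hlim := tendsto_lintegral_slopeAt hpdf.measurable hpdf.nonneg hpdf.map_eq hf3
    ((tendsto_add_atTop_iff_nat 1).2 hm) hmN
  -- A sample of size `N + 1` is one distinguished point and `N` others.
  rw [← tendsto_add_atTop_iff_nat 1]
  refine hlim.congr fun N => ?_
  rw [← lintegral_slopeError hpdf.measurable, ← map_sample_eq_pi hindep hident,
    lintegral_map' ((measurable_slopeError hpdf.measurable _ _).ennreal_ofReal.aemeasurable)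
      (aemeasurable_sample hident _), sub_zero, eLpNorm_one_eq_lintegral_enorm]
  exact lintegral_congr fun ω => (Real.enorm_of_nonneg (slopeError_nonneg _ _ _)).symm

lemma ae_tendsto_average (hindep : iIndepFun X P) (hident : ∀ i, IdentDistrib (X i) (X 0) P P)
    {g : ℝ → ℝ} (hg : Measurable g) (hint : Integrable (fun ω => g (X 0 ω)) P) :
    ∀ᵐ ω ∂P, Tendsto (fun n : ℕ => 1 / (n : ℝ) * ∑ i : Fin n, g (X i ω)) atTop
      (nhds (∫ ω, g (X 0 ω) ∂P)) := by
  have h := strong_law_ae_real (fun i ω => g (X i ω)) hint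
    (fun i j hij => (hindep.indepFun hij).comp hg hg) fun i => (hident i).comp hg
  filter_upwards [h] with ω hω
  refine hω.congr fun n => ?_
  rw [Finset.sum_range, div_eq_inv_mul, one_div]

end Sample

end

/-! ### Conclusion -/

theorem mainTheorem5 {Ω : Type*} [MeasurableSpace Ω] (P : Measure Ω) [IsProbabilityMeasure P]
    (X : ℕ → Ω → ℝ) (f : ℝ → ℝ) (m : ℕ → ℕ)
    (hindep : iIndepFun X P)
    (hident : ∀ i, IdentDistrib (X i) (X 0) P P)
    (hpdf : IsPdfOf f (X 0) P)
    (hvar : MemLp (X 0) 2 P)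
    (hVJ : Integrable (fun x => f x ^ 3) volume)
    (hm : Tendsto m atTop atTop)
    (hmn : Tendsto (fun n : ℕ => (m n : ℝ) / (n : ℝ)) atTop (nhds 0)) :
    TendstoInMeasure P
      (fun (n : ℕ) (ω : Ω) => correaVarextropy (m n) (fun i : Fin n => X i ω))
      atTop (fun _ => varextropy f (X 0) P) := by
  have hprob : IsProbabilityMeasure (P.map (X 0)) :=
    Measure.isProbabilityMeasure_map hpdf.aemeasurable
  have hf := hpdf.measurable
  have hfX : AEMeasurable (fun ω => f (X 0 ω)) P := hf.comp_aemeasurable hpdf.aemeasurable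
  have hL2 : MemLp (fun ω => f (X 0 ω)) 2 P := by
    rw [memLp_two_iff_integrable_sq hfX.aestronglyMeasurable]
    refine ⟨(hfX.pow_const 2).aestronglyMeasurable, ?_⟩
    rw [hasFiniteIntegral_iff_ofReal (ae_of_all _ fun _ => sq_nonneg _),
      ← lintegral_map' (f := fun x => ENNReal.ofReal (f x ^ 2)) (by fun_prop) hpdf.aemeasurable]
    exact (lintegral_maximalFunction_sq_lt_top hf hpdf.nonneg hpdf.map_eq hVJ).2
  have hvarext : varextropy f (X 0) P =
      1 / 4 * (∫ ω, f (X 0 ω) ^ 2 ∂P - (∫ ω, f (X 0 ω) ∂P) ^ 2) := by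
    unfold varextropy
    rw [variance_const_mul, variance_eq_sub hL2]
    simp only [Pi.pow_apply]
    ring
  have hmeas : ∀ n, AEStronglyMeasurable
      (fun ω => correaVarextropy (m n) (fun i : Fin n => X i ω)) P := fun n =>
    ((measurable_correaVarextropy (m n) n).comp_aemeasurable
      (aemeasurable_sample hident n)).aestronglyMeasurable
  rw [hvarext]
  -- The averages of `f` converge almost surely but the slope error only in probability; along
  -- subsequences both converge almost surely, and the comparison becomes deterministic.
  refine (exists_seq_tendstoInMeasure_atTop_iff hmeas).2 fun ns hns => ?_
  obtain ⟨ns', hns', hD⟩ := ((tendstoInMeasure_slopeError hindep hident hpdf hVJ hm hmn).comp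
    hns.tendsto_atTop).exists_seq_tendsto_ae
  refine ⟨ns', hns', ?_⟩
  have hlim : Tendsto (fun k => ns (ns' k)) atTop atTop :=
    hns.tendsto_atTop.comp hns'.tendsto_atTop
  filter_upwards [hD, ae_tendsto_average hindep hident hf (hL2.integrable (by norm_num)),
    ae_tendsto_average hindep hident (hf.pow_const 2) hL2.integrable_sq] with ω h1 h2 h3
  exact tendsto_correaVarextropy (z := fun n (i : Fin n) => X i ω) hlim (h2.comp hlim)
    (h3.comp hlim) h1
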